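/- The baker's map is the bijection $B$ of $[0,1)^2$ given by $B(x,y)=(2x,\frac y2)$ if $x<\frac12$ and $B(x,y)=(2x-1,\frac{y+1}2)$ if $x\ge\frac12$. For $H\subset\mathbb R^2$ let $\mathcal J(H)=\{(x,y)\in[0,1)^2: B^n(x,y)\notin H\text{ for all }n\in\mathbb Z\}$ be its survivor set. An open set $H$ is called a dimension trap if $\dim_{\mathtt H}\mathcal J(H)=0$. Let $\pi:\{0,1\}^{\mathbb Z}\to[0,1]^2$, $\pi(s)=\left(\sum_{n\ge1}s_n2^{-n},\ \sum_{n\ge0}s_{-n}2^{-n-1}\right)$, let $\sigma$ be the left shift, and let $\overline{\mathcal J}(H)=\{\pi(s): \pi(\sigma^n s)\notin H\text{ for all }n\in\mathbb Z\}$ be the survivor set in the closed square. Let $\Delta$ be the open quadrilateral with vertices $(0,1),(\frac12,1),(\frac13,\frac23),(0,\frac12)$, let $\Delta'$ be the open quadrilateral with vertices $(0,\frac12),(\frac5{24},\frac23),(\frac12,1),(0,1)$, and let $\Delta''$ be the open quadrilateral with vertices $(0,\frac12),(\frac13,\frac{19}{24}),(\frac12,1),(0,1)$. **Theorem.** (1)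 $\Delta'$ and $\Delta''$ are dimension traps; moreover $\dim_{\mathtt H}\overline{\mathcal J}(\Delta')=\dim_{\mathtt H}\overline{\mathcal J}(\Delta'')=0$. (2) The projections of $\mathcal J(\Delta')$ and of $\mathcal J(\Delta'')$ onto the $x$-axis and onto the $y$-axis all have Hausdorff dimension $0$. (3) Every convex dimension trap $H\subset\Delta$ satisfies $\Delta'\subset H$ or $\Delta''\subset H$, and $\Delta'$ and $\Delta''$ are exactly the minimal elements, with respect to inclusion, of the family of convex dimension traps contained in $\Delta$. (4) $\Delta'$ and $\Delta''$ both have area $\frac{13}{96}$. -/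

import Mathlib

open Set MeasureTheory

/-- The half-open unit square `[0,1) × [0,1)`, on which the baker's map is a bijection. -/
def unitSquare : Set (ℝ × ℝ) := Ico 0 1 ×ˢ Ico 0 1

/-- The formula of the baker's map `B`. -/
noncomputable def bakerFun (p : ℝ × ℝ) : ℝ × ℝ :=
  if p.1 < 1 / 2 then (2 * p.1, p.2 / 2) else (2 * p.1 - 1, (p.2 + 1) / 2)

/-- The formula of the inverse of the baker's map. -/
noncomputable def bakerInvFun (p : ℝ × ℝ) : ℝ × ℝ :=
  if p.2 < 1 / 2 then (p.1 / 2, 2 * p.2) else ((p.1 + 1) / 2, 2 * p.2 - 1)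

theorem bakerFun_mem {p : ℝ × ℝ} (hp : p ∈ unitSquare) : bakerFun p ∈ unitSquare := by
  obtain ⟨⟨h1, h2⟩, h3, h4⟩ := hp
  unfold bakerFun
  split_ifs with h
  · refine ⟨⟨?_, ?_⟩, ?_, ?_⟩ <;> dsimp only <;> linarith
  · refine ⟨⟨?_, ?_⟩, ?_, ?_⟩ <;> dsimp only <;> linarith

theorem bakerInvFun_mem {p : ℝ × ℝ} (hp : p ∈ unitSquare) : bakerInvFun p ∈ unitSquare := by
  obtain ⟨⟨h1, h2⟩, h3, h4⟩ := hp
  unfold bakerInvFun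
  split_ifs with h
  · refine ⟨⟨?_, ?_⟩, ?_, ?_⟩ <;> dsimp only <;> linarith
  · refine ⟨⟨?_, ?_⟩, ?_, ?_⟩ <;> dsimp only <;> linarith

theorem bakerInvFun_bakerFun {p : ℝ × ℝ} (hp : p ∈ unitSquare) :
    bakerInvFun (bakerFun p) = p := by
  obtain ⟨⟨h1, h2⟩, h3, h4⟩ := hp
  obtain ⟨x, y⟩ := p
  dsimp only at h1 h2 h3 h4
  by_cases h : x < 1 / 2
  · have h' : y / 2 < 1 / 2 := by linarith
    simp only [bakerFun, bakerInvFun, if_pos h, if_pos h']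
    exact Prod.ext (by dsimp only; ring) (by dsimp only; ring)
  · have h' : ¬ (y + 1) / 2 < 1 / 2 := by linarith
    simp only [bakerFun, bakerInvFun, if_neg h, if_neg h']
    exact Prod.ext (by dsimp only; ring) (by dsimp only; ring)

theorem bakerFun_bakerInvFun {p : ℝ × ℝ} (hp : p ∈ unitSquare) :
    bakerFun (bakerInvFun p) = p := by
  obtain ⟨⟨h1, h2⟩, h3, h4⟩ := hp
  obtain ⟨x, y⟩ := p
  dsimp only at h1 h2 h3 h4
  by_cases h : y < 1 / 2
  · have h' : x / 2 < 1 / 2 := by linarith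
    simp only [bakerFun, bakerInvFun, if_pos h, if_pos h']
    exact Prod.ext (by dsimp only; ring) (by dsimp only; ring)
  · have h' : ¬ (x + 1) / 2 < 1 / 2 := by linarith
    simp only [bakerFun, bakerInvFun, if_neg h, if_neg h']
    exact Prod.ext (by dsimp only; ring) (by dsimp only; ring)

/-- The baker's map as a bijection of the half-open unit square; its integer powers `B ^ n` are
the iterates (and, for negative `n`, the iterates of the inverse). -/
noncomputable def baker : Equiv.Perm unitSquare where
  toFun p := ⟨bakerFun p, bakerFun_mem p.2⟩
  invFun p := ⟨bakerInvFun p, bakerInvFun_mem p.2⟩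
  left_inv p := Subtype.ext (bakerInvFun_bakerFun p.2)
  right_inv p := Subtype.ext (bakerFun_bakerInvFun p.2)

/-- The survivor set `𝒥(H)`: the points whose two-sided orbit under the baker's map avoids `H`. -/
def survivorSet (H : Set (ℝ × ℝ)) : Set (ℝ × ℝ) :=
  {p | ∃ hp : p ∈ unitSquare, ∀ n : ℤ, (((baker ^ n) ⟨p, hp⟩ : unitSquare) : ℝ × ℝ) ∉ H}

/-- The coding map `π` from bi-infinite 0-1 sequences onto the closed unit square:
`x = 0.s₁s₂s₃…` and `y = 0.s₀s₋₁s₋₂…` in base 2. -/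
noncomputable def codingMap (s : ℤ → Fin 2) : ℝ × ℝ :=
  (∑' n : ℕ, ((s ((n : ℤ) + 1) : ℕ) : ℝ) / 2 ^ (n + 1),
   ∑' n : ℕ, ((s (-(n : ℤ)) : ℕ) : ℝ) / 2 ^ (n + 1))

/-- The survivor set in the closed unit square, through the conjugacy of the baker's map with the
left shift: the images under `π` of the sequences no shift of which is mapped into `H`.
It also contains points with a coordinate equal to `1` and orbits coded by the second binary
expansion of a dyadic rational. -/
def codedSurvivorSet (H : Set (ℝ × ℝ)) : Set (ℝ × ℝ) :=
  codingMap '' {s | ∀ n : ℤ, codingMap (fun i => s (i + n)) ∉ H}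

/-- An open set `H` is a dimension trap if its survivor set has Hausdorff dimension zero. -/
def IsDimensionTrap (H : Set (ℝ × ℝ)) : Prop :=
  IsOpen H ∧ dimH (survivorSet H) = 0

/-- The open quadrilateral `Δ`. -/
def bigDelta : Set (ℝ × ℝ) :=
  interior (convexHull ℝ {(0, 1), (1 / 2, 1), (1 / 3, 2 / 3), (0, 1 / 2)})

/-- The open quadrilateral `Δ'`. -/
def deltaPrime : Set (ℝ × ℝ) :=
  interior (convexHull ℝ {(0, 1 / 2), (5 / 24, 2 / 3), (1 / 2, 1), (0, 1)})

/-- The open quadrilateral `Δ''`. -/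
def deltaDoublePrime : Set (ℝ × ℝ) :=
  interior (convexHull ℝ {(0, 1 / 2), (1 / 3, 19 / 24), (1 / 2, 1), (0, 1)})

/-- The convex dimension traps contained in `Δ`. -/
def IsConvexTrapInDelta (H : Set (ℝ × ℝ)) : Prop :=
  IsDimensionTrap H ∧ Convex ℝ H ∧ H ⊆ bigDelta

/-! Code an orbit by a bi-infinite 0-1 sequence; its points are `(rightValue s i, leftValue s i)`. A
point of `Δ` has `x < 1/2 < y`, so it sits at an occurrence of `10`, and avoiding `Δ'` is a
condition at the end of each run of ones.

Smallness of the survivors. Between consecutive occurrences of `01` the sequence reads as a block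
`1^m 0^n`. Avoiding `Δ'` forces `m = 1` or `n = 1`, so a block is described by its type `m - n`, an
arbitrary integer. The heart of the proof is that the type can descend only boundedly often
(`BlockChain.false_of_descents`). The sides of `Δ'` give inequalities between `z` (the past of a
block) and `u` (its future), and the values at the fixed points of the block recursions act as
barriers: once `z` or `u` has crossed one, it cannot return. Hence the types are monotone near each
end of the sequence. They are eventually constant, which makes the tail periodic, or they diverge,
which isolates one of the letters ever more strongly (`tailSmall_right`, `tailSmall_left`). For
every `L` such tails form countably many families with about `(L+1)^k` words of length `L * k`, so
pairs of them have dimension zero (`dimH_pairValue_tailSmall`). Reversing the sequence and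
exchanging its letters is the reflection `(x, y) ↦ (1 - y, 1 - x)`, which carries `Δ''` to `Δ'`.

Minimality. The free concatenations of two distinct words code a set of positive dimension, so a
dimension trap meets the orbit of one of them (`exists_splice_mem`). Suitable words have orbits that
meet `Δ` only near a prescribed place. This puts `(0, 1)`, `(0, 1/2)` and `(1/2, 1)` in the closure
of every trap inside `Δ`. Perturbing the alternating sequence gives a further point, on the segment
from `(1/3, 2/3)` to `(1/3, 19/24)` or on the one to `(5/24, 2/3)` (`exists_mem_closure_segments`).
By convexity the fourth vertex of `Δ''` or of `Δ'` is in the closure too, and an open convex set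
contains the interior of its closure. -/

/-! ### Binary values of the two halves of a bi-infinite sequence -/

/-- The number `0.s_{i+1}s_{i+2}…` in base 2. -/
noncomputable def rightValue (s : ℤ → Fin 2) (i : ℤ) : ℝ :=
  Real.ofDigits (fun n : ℕ => s (i + 1 + n))

/-- The number `0.s_i s_{i-1}…` in base 2. -/
noncomputable def leftValue (s : ℤ → Fin 2) (i : ℤ) : ℝ :=
  Real.ofDigits (fun n : ℕ => s (i - n))

theorem codingMap_eq (s : ℤ → Fin 2) : codingMap s =
    (Real.ofDigits (fun n : ℕ => s (n + 1)), Real.ofDigits (fun n : ℕ => s (-n))) := by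
  simp [codingMap, Real.ofDigits, Real.ofDigitsTerm, div_eq_mul_inv]

theorem codingMap_shift (s : ℤ → Fin 2) (i : ℤ) :
    codingMap (fun j => s (j + i)) = (rightValue s i, leftValue s i) := by
  rw [codingMap_eq, rightValue, leftValue]
  congr 3 <;> funext n <;> congr 1 <;> ring

theorem Real.ofDigits_two_step (d : ℕ → Fin 2) :
    Real.ofDigits d = ((d 0 : ℕ) + Real.ofDigits (fun n => d (n + 1))) / 2 := by
  have h := Real.ofDigits_eq_sum_add_ofDigits d 1
  simp only [Finset.sum_range_one, Real.ofDigitsTerm] at h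
  rw [h]; push_cast; ring

theorem rightValue_step (s : ℤ → Fin 2) (i : ℤ) :
    rightValue s i = ((s (i + 1) : ℕ) + rightValue s (i + 1)) / 2 := by
  rw [rightValue, Real.ofDigits_two_step, rightValue]
  have : (fun n : ℕ => s (i + 1 + ((n + 1 : ℕ) : ℤ))) = fun n : ℕ => s (i + 1 + 1 + n) := by
    funext n; congr 1; push_cast; ring
  rw [this]; simp

theorem leftValue_step (s : ℤ → Fin 2) (i : ℤ) :
    leftValue s i = ((s i : ℕ) + leftValue s (i - 1)) / 2 := by
  rw [leftValue, Real.ofDigits_two_step, leftValue]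
  have : (fun n : ℕ => s (i - ((n + 1 : ℕ) : ℤ))) = fun n : ℕ => s (i - 1 - n) := by
    funext n; congr 1; push_cast; ring
  rw [this]; simp

theorem rightValue_nonneg (s : ℤ → Fin 2) (i : ℤ) : 0 ≤ rightValue s i := Real.ofDigits_nonneg _
theorem rightValue_le_one (s : ℤ → Fin 2) (i : ℤ) : rightValue s i ≤ 1 := Real.ofDigits_le_one _
theorem leftValue_nonneg (s : ℤ → Fin 2) (i : ℤ) : 0 ≤ leftValue s i := Real.ofDigits_nonneg _
theorem leftValue_le_one (s : ℤ → Fin 2) (i : ℤ) : leftValue s i ≤ 1 := Real.ofDigits_le_one _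

theorem rightValue_of_zeros {s : ℤ → Fin 2} {i : ℤ} {n : ℕ}
    (h : ∀ j, i < j → j ≤ i + n → s j = 0) :
    rightValue s i = (1 / 2) ^ n * rightValue s (i + n) := by
  induction n with
  | zero => simp
  | succ n ih =>
    rw [ih fun j h1 h2 => h j h1 (by push_cast; omega), rightValue_step s (i + n),
      h (i + n + 1) (by omega) (by push_cast; omega)]
    push_cast; rw [add_assoc]; simp; ring

theorem rightValue_of_ones {s : ℤ → Fin 2} {i : ℤ} {n : ℕ}
    (h : ∀ j, i < j → j ≤ i + n → s j = 1) :
    rightValue s i = 1 - (1 / 2) ^ n * (1 - rightValue s (i + n)) := by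
  induction n with
  | zero => simp
  | succ n ih =>
    rw [ih fun j h1 h2 => h j h1 (by push_cast; omega), rightValue_step s (i + n),
      h (i + n + 1) (by omega) (by push_cast; omega)]
    push_cast; rw [add_assoc]; simp; ring

theorem leftValue_of_zeros {s : ℤ → Fin 2} {i : ℤ} {n : ℕ}
    (h : ∀ j, i - n < j → j ≤ i → s j = 0) :
    leftValue s i = (1 / 2) ^ n * leftValue s (i - n) := by
  induction n with
  | zero => simp
  | succ n ih =>
    rw [ih fun j h1 h2 => h j (by push_cast; omega) h2, leftValue_step s (i - n),
      h (i - n) (by push_cast; omega) (by omega)]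
    push_cast; rw [← sub_sub]; simp; ring

theorem leftValue_of_ones {s : ℤ → Fin 2} {i : ℤ} {n : ℕ}
    (h : ∀ j, i - n < j → j ≤ i → s j = 1) :
    leftValue s i = 1 - (1 / 2) ^ n * (1 - leftValue s (i - n)) := by
  induction n with
  | zero => simp
  | succ n ih =>
    rw [ih fun j h1 h2 => h j (by push_cast; omega) h2, leftValue_step s (i - n),
      h (i - n) (by push_cast; omega) (by omega)]
    push_cast; rw [← sub_sub]; simp; ring

/-! ### Chains of blocks `1^m 0^n` -/

/-- The relations between consecutive blocks `1^{m k} 0^{n k}`, `A ≤ k ≤ B`, of a sequence that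
avoids `deltaPrime`. The number `z k` is read leftwards from the second letter before block `k`,
and `u k` rightwards from the second letter of block `k`. -/
structure BlockChain (A B : ℤ) (m n : ℤ → ℕ) (z u : ℤ → ℝ) : Prop where
  one_le_m : ∀ k, A ≤ k → k ≤ B → 1 ≤ m k
  one_le_n : ∀ k, A ≤ k → k ≤ B → 1 ≤ n k
  z_nonneg : ∀ k, 0 ≤ z k
  z_le_one : ∀ k, z k ≤ 1
  u_nonneg : ∀ k, 0 ≤ u k
  u_le_one : ∀ k, u k ≤ 1
  z_succ : ∀ k, A ≤ k → k ≤ B → z (k + 1) =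
    2 * (1 / 2) ^ n k * (1 - (1 / 2) ^ m k + (1 / 2) ^ m k * z k / 2)
  u_eq : ∀ k, A ≤ k → k ≤ B → u k =
    1 - 2 * (1 / 2) ^ m k + (1 / 2) ^ m k * (1 / 2) ^ n k * (1 + u (k + 1))
  cond : ∀ k, A ≤ k → k ≤ B →
    1 - (1 / 2) ^ m k + (1 / 2) ^ m k * z k / 2 ≤
        1 / 2 + 4 / 5 * ((1 / 2) ^ n k * (1 + u (k + 1)) / 2) ∨
      1 - (1 / 2) ^ m k + (1 / 2) ^ m k * z k / 2 ≤
        3 / 7 + 8 / 7 * ((1 / 2) ^ n k * (1 + u (k + 1)) / 2)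

theorem half_pow_le {a b : ℕ} (h : a ≤ b) : ((1 : ℝ) / 2) ^ b ≤ (1 / 2) ^ a :=
  pow_le_pow_of_le_one (by norm_num) (by norm_num) h

/-- The type of a block. -/
def blockType (m n : ℤ → ℕ) (k : ℤ) : ℤ := (m k : ℤ) - n k

namespace BlockChain

variable {A B : ℤ} {m n : ℤ → ℕ} {z u : ℤ → ℝ}

theorem mono (h : BlockChain A B m n z u) {A' B' : ℤ} (hA : A ≤ A') (hB : B' ≤ B) :
    BlockChain A' B' m n z u where
  one_le_m k h1 h2 := h.one_le_m k (hA.trans h1) (h2.trans hB)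
  one_le_n k h1 h2 := h.one_le_n k (hA.trans h1) (h2.trans hB)
  z_nonneg := h.z_nonneg
  z_le_one := h.z_le_one
  u_nonneg := h.u_nonneg
  u_le_one := h.u_le_one
  z_succ k h1 h2 := h.z_succ k (hA.trans h1) (h2.trans hB)
  u_eq k h1 h2 := h.u_eq k (hA.trans h1) (h2.trans hB)
  cond k h1 h2 := h.cond k (hA.trans h1) (h2.trans hB)

/-- If both runs had length at least two, then `y ≥ 3/4` and `x ≤ 1/4`, where the lower sides of
`Δ'` have heights at most `7/10` and `5/7`. -/
theorem one_or_one (h : BlockChain A B m n z u) {k : ℤ} (h1 : A ≤ k) (h2 : k ≤ B) :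
    m k = 1 ∨ n k = 1 := by
  by_contra! hc
  have hm : 2 ≤ m k := by have := h.one_le_m k h1 h2; omega
  have hn : 2 ≤ n k := by have := h.one_le_n k h1 h2; omega
  have ha := half_pow_le hm
  have hb := half_pow_le hn
  have ha0 : (0 : ℝ) < (1 / 2) ^ m k := by positivity
  have hb0 : (0 : ℝ) < (1 / 2) ^ n k := by positivity
  have hcond := h.cond k h1 h2
  have hz := h.z_nonneg k
  have hu := h.u_le_one (k + 1)
  have e1 : (1 / 2 : ℝ) ^ n k * (1 + u (k + 1)) ≤ (1 / 2) ^ 2 * 2 := by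
    apply mul_le_mul hb (by linarith) (by linarith [h.u_nonneg (k + 1)]) (by norm_num)
  have e2 : 0 ≤ (1 / 2 : ℝ) ^ m k * z k := by positivity
  rcases hcond with hc | hc <;> linarith

theorem type_nonneg (h : BlockChain A B m n z u) {k : ℤ} (h1 : A ≤ k) (h2 : k ≤ B)
    (hq : 0 ≤ blockType m n k) : n k = 1 ∧ (m k : ℤ) = blockType m n k + 1 := by
  have := h.one_or_one h1 h2
  have := h.one_le_m k h1 h2
  have := h.one_le_n k h1 h2
  unfold blockType at *
  omega

theorem type_nonpos (h : BlockChain A B m n z u) {k : ℤ} (h1 : A ≤ k) (h2 : k ≤ B)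
    (hq : blockType m n k ≤ 0) : m k = 1 ∧ (n k : ℤ) = 1 - blockType m n k := by
  have := h.one_or_one h1 h2
  have := h.one_le_m k h1 h2
  have := h.one_le_n k h1 h2
  unfold blockType at *
  omega

/-- The recursions have the fixed points `z = 2/3` and `u = 1/3`, the coordinates of the orbit of
period two; these are the barriers used for small types. -/
theorem of_type_zero (h : BlockChain A B m n z u) {k : ℤ} (h1 : A ≤ k) (h2 : k ≤ B)
    (hq : blockType m n k = 0) : z (k + 1) = 1 / 2 + z k / 4 ∧ u k = (1 + u (k + 1)) / 4 := by
  obtain ⟨hn, hm⟩ := h.type_nonneg h1 h2 hq.ge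
  have hm : m k = 1 := by omega
  have e1 := h.z_succ k h1 h2
  have e2 := h.u_eq k h1 h2
  rw [hm, hn] at e1 e2
  constructor <;> linarith

theorem of_type_one (h : BlockChain A B m n z u) {k : ℤ} (h1 : A ≤ k) (h2 : k ≤ B)
    (hq : blockType m n k = 1) : z (k + 1) = 3 / 4 + z k / 8 ∧ u k = 5 / 8 + u (k + 1) / 8 ∧
      3 / 4 + z k / 8 ≤ 3 / 7 + 2 / 7 * (1 + u (k + 1)) := by
  obtain ⟨hn, hm⟩ := h.type_nonneg h1 h2 (by omega)
  have hm : m k = 2 := by omega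
  have e1 := h.z_succ k h1 h2
  have e2 := h.u_eq k h1 h2
  have e3 := h.cond k h1 h2
  rw [hm, hn] at e1 e2 e3
  have := h.z_nonneg k
  have := h.u_nonneg (k + 1)
  have := h.u_le_one (k + 1)
  -- Here `x ≥ 1/4`, to the right of the vertex `(5/24, 2/3)`, so the steeper side is the higher one
  -- and either alternative implies its inequality.
  refine ⟨by linarith, by linarith, ?_⟩
  rcases e3 with e3 | e3 <;> linarith

theorem of_type_neg_one (h : BlockChain A B m n z u) {k : ℤ} (h1 : A ≤ k) (h2 : k ≤ B)
    (hq : blockType m n k = -1) : z (k + 1) = 1 / 4 + z k / 8 ∧ u k = (1 + u (k + 1)) / 8 ∧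
      (z k ≤ 2 / 5 * (1 + u (k + 1)) ∨ z k ≤ 2 / 7 + 4 / 7 * u (k + 1)) := by
  obtain ⟨hm, hn⟩ := h.type_nonpos h1 h2 (by omega)
  have hn : n k = 2 := by omega
  have e1 := h.z_succ k h1 h2
  have e2 := h.u_eq k h1 h2
  have e3 := h.cond k h1 h2
  rw [hm, hn] at e1 e2 e3
  refine ⟨by linarith, by linarith, ?_⟩
  rcases e3 with e3 | e3
  · left; linarith
  · right; linarith

theorem le_z_of_two_le_type (h : BlockChain A B m n z u) {k : ℤ} (h1 : A ≤ k) (h2 : k ≤ B)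
    (hq : 2 ≤ blockType m n k) : 7 / 8 ≤ z (k + 1) := by
  obtain ⟨hn, hm⟩ := h.type_nonneg h1 h2 (by omega)
  have ha : ((1 : ℝ) / 2) ^ m k ≤ (1 / 2) ^ 3 := half_pow_le (by omega)
  have ha0 : (0 : ℝ) < (1 / 2) ^ m k := by positivity
  have e1 := h.z_succ k h1 h2
  have : 0 ≤ (1 / 2 : ℝ) ^ m k * z k := mul_nonneg ha0.le (h.z_nonneg k)
  rw [hn] at e1
  linarith

theorem u_le_of_type_neg (h : BlockChain A B m n z u) {k : ℤ} (h1 : A ≤ k) (h2 : k ≤ B)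
    (hq : blockType m n k ≤ -1) : u k ≤ 1 / 4 := by
  obtain ⟨hm, hn⟩ := h.type_nonpos h1 h2 (by omega)
  have hb : ((1 : ℝ) / 2) ^ n k ≤ (1 / 2) ^ 2 := half_pow_le (by omega)
  have e2 := h.u_eq k h1 h2
  have e : (1 / 2 : ℝ) ^ n k * (1 + u (k + 1)) ≤ (1 / 2) ^ 2 * 2 := by
    apply mul_le_mul hb (by linarith [h.u_le_one (k + 1)]) (by linarith [h.u_nonneg (k + 1)])
      (by norm_num)
  rw [hm] at e2
  linarith

theorem z_pos (h : BlockChain A B m n z u) {k : ℤ} (h1 : A < k) (h2 : k ≤ B + 1) : 0 < z k := by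
  have e1 := h.z_succ (k - 1) (by omega) (by omega)
  rw [sub_add_cancel] at e1
  have ha : ((1 : ℝ) / 2) ^ m (k - 1) ≤ (1 / 2) ^ 1 :=
    half_pow_le (h.one_le_m _ (by omega) (by omega))
  have hb0 : (0 : ℝ) < (1 / 2) ^ n (k - 1) := by positivity
  have := mul_nonneg (by positivity : (0 : ℝ) ≤ (1 / 2) ^ m (k - 1)) (h.z_nonneg (k - 1))
  rw [e1]
  apply mul_pos (by positivity)
  linarith

/-- If the type is positive, the run of ones at the next block is constrained. -/
theorem cond_of_type_pos (h : BlockChain A B m n z u) {k : ℤ} (h1 : A ≤ k) (h2 : k ≤ B)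
    (hq : 1 ≤ blockType m n k) :
    1 - u (k + 1) ≤ 7 / 2 * (1 / 2) ^ m k * (1 - z k / 2) := by
  obtain ⟨hn, hm⟩ := h.type_nonneg h1 h2 (by omega)
  have ha : ((1 : ℝ) / 2) ^ m k ≤ (1 / 2) ^ 2 := half_pow_le (by omega)
  have e3 := h.cond k h1 h2
  rw [hn] at e3
  have := mul_nonneg (by positivity : (0 : ℝ) ≤ (1 / 2) ^ m k) (h.z_nonneg k)
  have := h.u_nonneg (k + 1)
  have := h.u_le_one (k + 1)
  rcases e3 with e3 | e3 <;> linarith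

/-- A deeper drop would place the orbit above both lower sides: for positive types the run of ones
at block `k` would be too long for the next one, for nonpositive types the zeros at block `k + 1`
too many for the preceding ones. -/
theorem descent_step (h : BlockChain A B m n z u) {k : ℤ} (h1 : A ≤ k) (h2 : k + 1 ≤ B)
    (hq : blockType m n (k + 1) < blockType m n k) :
    blockType m n (k + 1) = blockType m n k - 1 ∨
      (blockType m n k = 1 ∧ blockType m n (k + 1) = -1) := by
  have hm1 := h.one_le_m (k + 1) (by omega) h2
  have hn1 := h.one_le_n (k + 1) (by omega) h2
  rcases le_or_gt 1 (blockType m n k) with hk | hk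
  · obtain ⟨hn, hm⟩ := h.type_nonneg h1 (by omega) (by omega)
    have e1 := h.cond_of_type_pos h1 (by omega) hk
    have e2 := h.u_eq (k + 1) (by omega) h2
    have ha0 : (0 : ℝ) < (1 / 2) ^ m k := by positivity
    have ha0' : (0 : ℝ) < (1 / 2) ^ m (k + 1) := by positivity
    have hb' : ((1 : ℝ) / 2) ^ n (k + 1) ≤ (1 / 2) ^ 1 := half_pow_le hn1
    -- The recursion for `u` gives `1 - u (k + 1) ≥ (1/2) ^ m (k + 1)`. Since `7/2 < 4`, the run of
    -- ones can shrink by at most one letter.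
    have hle : ((1 : ℝ) / 2) ^ m (k + 1) ≤ 7 / 2 * (1 / 2) ^ m k := by
      have h3 : ((1 : ℝ) / 2) ^ m (k + 1) * (1 / 2) ^ n (k + 1) * (1 + u (k + 1 + 1)) ≤
          (1 / 2) ^ m (k + 1) * (1 / 2) ^ 1 * 2 := by
        apply mul_le_mul (mul_le_mul_of_nonneg_left hb' ha0'.le)
          (by linarith [h.u_le_one (k + 1 + 1)]) (by linarith [h.u_nonneg (k + 1 + 1)])
          (by positivity)
      have := mul_nonneg ha0.le (h.z_nonneg k)
      linarith
    have hmm : m k ≤ m (k + 1) + 1 := by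
      by_contra! hc
      have := half_pow_le (show m (k + 1) + 2 ≤ m k by omega)
      rw [pow_add] at this
      linarith
    rcases Nat.lt_or_ge (m (k + 1)) 2 with hm2 | hm2
    · have hm2 : m (k + 1) = 1 := by omega
      have hk1 : blockType m n k = 1 := by
        unfold blockType at *; omega
      obtain ⟨e3, -, -⟩ := h.of_type_one h1 (by omega) hk1
      by_cases hn3 : 3 ≤ n (k + 1)
      · exfalso
        have hb3 : ((1 : ℝ) / 2) ^ n (k + 1) ≤ (1 / 2) ^ 3 := half_pow_le hn3
        have e4 := h.cond (k + 1) (by omega) h2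
        have e : (1 / 2 : ℝ) ^ n (k + 1) * (1 + u (k + 1 + 1)) ≤ (1 / 2) ^ 3 * 2 := by
          apply mul_le_mul hb3 (by linarith [h.u_le_one (k + 1 + 1)])
            (by linarith [h.u_nonneg (k + 1 + 1)]) (by norm_num)
        have := h.z_nonneg k
        rw [hm2, e3] at e4
        rcases e4 with e4 | e4 <;> linarith
      · unfold blockType at *; omega
    · have := h.one_or_one (k := k + 1) (by omega) h2
      unfold blockType at *; omega
  · obtain ⟨hm, hn⟩ := h.type_nonpos h1 (by omega) (by omega)
    obtain ⟨hm', hn'⟩ := h.type_nonpos (k := k + 1) (by omega) h2 (by omega)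
    by_contra hc
    have hnn : n k + 2 ≤ n (k + 1) := by omega
    have hb := half_pow_le hnn
    have hb1 : ((1 : ℝ) / 2) ^ n k ≤ (1 / 2) ^ 1 := half_pow_le (by omega)
    have hb0 : (0 : ℝ) < (1 / 2) ^ n k := by positivity
    rw [pow_add] at hb
    have e1 := h.z_succ k h1 (by omega)
    have e4 := h.cond (k + 1) (by omega) h2
    rw [hm] at e1
    rw [hm'] at e4
    have e : (1 / 2 : ℝ) ^ n (k + 1) * (1 + u (k + 1 + 1)) ≤ (1 / 2) ^ n k * (1 / 2) ^ 2 * 2 := by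
      apply mul_le_mul hb (by linarith [h.u_le_one (k + 1 + 1)])
        (by linarith [h.u_nonneg (k + 1 + 1)]) (by positivity)
    have := mul_nonneg hb0.le (h.z_nonneg k)
    rcases e4 with e4 | e4 <;> linarith

/-- The bound `6/7` is the fixed point of the type-one recursion `z ↦ 3/4 + z/8`. A drop by one
makes `1 - u (k + 1)` at least `2 * (1/2) ^ m k`, and the condition on the steep side then reads `2
≤ 7/2 * (1 - z k / 2)`. -/
theorem z_le_of_descent (h : BlockChain A B m n z u) {k : ℤ} (h1 : A ≤ k) (h2 : k + 1 ≤ B)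
    (hq : blockType m n (k + 1) < blockType m n k) (hk : 1 ≤ blockType m n k) : z k ≤ 6 / 7 := by
  have e1 := h.cond_of_type_pos h1 (by omega) hk
  have e2 := h.u_eq (k + 1) (by omega) h2
  obtain ⟨hn, hm⟩ := h.type_nonneg h1 (by omega) (by omega)
  have ha0 : (0 : ℝ) < (1 / 2) ^ m k := by positivity
  rcases h.descent_step h1 h2 hq with hs | ⟨hs1, hs2⟩
  · obtain ⟨hn', hm'⟩ := h.type_nonneg (k := k + 1) (by omega) h2 (by omega)
    have hmm : m k = m (k + 1) + 1 := by omega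
    have ha' : ((1 : ℝ) / 2) ^ m (k + 1) = 2 * (1 / 2) ^ m k := by rw [hmm, pow_succ]; ring
    rw [hn', ha'] at e2
    have := mul_nonneg ha0.le (sub_nonneg.2 (h.u_le_one (k + 1 + 1)))
    by_contra! hc
    have := mul_pos ha0 (sub_pos.2 hc)
    linarith
  · obtain ⟨-, e3, -⟩ := h.of_type_neg_one (k := k + 1) (by omega) h2 hs2
    obtain ⟨-, -, e4⟩ := h.of_type_one h1 (by omega) hs1
    linarith [h.u_le_one (k + 1 + 1)]

/-- After a descent from type at least two there is no further descent. -/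
theorem no_descent_after (h : BlockChain A B m n z u) {k : ℤ} (h1 : A ≤ k) (h2 : k + 1 ≤ B)
    (hq : blockType m n (k + 1) < blockType m n k) (hk : 2 ≤ blockType m n k) {j : ℤ}
    (hkj : k < j) (hj : j + 1 ≤ B) : blockType m n j ≤ blockType m n (j + 1) := by
  -- The barrier `6/7` persists: type one preserves `z > 6/7`, a type of at least two yields `z ≥
  -- 7/8`, and a descent from a positive type would need `z ≤ 6/7`.
  have key : ∀ i, k + 1 ≤ i → i + 1 ≤ B → 1 ≤ blockType m n i ∧ 6 / 7 < z i := by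
    intro i hi
    induction i, hi using Int.leInduction with
    | base =>
      intro _
      have := h.descent_step h1 h2 hq
      exact ⟨by omega, by linarith [h.le_z_of_two_le_type h1 (by omega) hk]⟩
    | succ i hi ih =>
      intro hB
      obtain ⟨i1, i2⟩ := ih (by omega)
      have hge : blockType m n i ≤ blockType m n (i + 1) := by
        by_contra! hc
        linarith [h.z_le_of_descent (by omega) (by omega) hc i1]
      refine ⟨by omega, ?_⟩
      rcases (show blockType m n i = 1 ∨ 2 ≤ blockType m n i by omega) with hi1 | hi1
      · rw [(h.of_type_one (by omega) (by omega) hi1).1]; linarith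
      · linarith [h.le_z_of_two_le_type (by omega) (by omega) hi1]
  by_contra! hc
  obtain ⟨i1, i2⟩ := key j (by omega) hj
  linarith [h.z_le_of_descent (by omega) hj hc i1]

/-- After a descent to a negative type, the next type is nonnegative. -/
theorem nonneg_after_descent (h : BlockChain A B m n z u) {k : ℤ} (h1 : A < k) (h2 : k + 2 ≤ B)
    (hq : blockType m n (k + 1) < blockType m n k) (hk : blockType m n (k + 1) ≤ -1) :
    0 ≤ blockType m n (k + 2) := by
  by_contra! hc
  have hu := h.u_le_of_type_neg (k := k + 2) (by omega) h2 (by omega)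
  have e4 := h.cond (k + 1) (by omega) (by omega)
  rw [show k + 1 + 1 = k + 2 by ring] at e4
  -- Strict positivity is essential: with `u (k + 2) ≤ 1/4` a drop by one leads to the borderline
  -- `4/5 * 5/16 = 1/4`, and only `z k > 0` breaks the tie. This is why the block `k` must not be
  -- the first one.
  have hz := h.z_pos h1 (by omega)
  have hu0 := h.u_nonneg (k + 2)
  obtain ⟨hm', hn'⟩ := h.type_nonpos (k := k + 1) (by omega) (by omega) (by omega)
  rcases h.descent_step h1.le (by omega) hq with hs | ⟨hs1, hs2⟩
  · obtain ⟨hm, hn⟩ := h.type_nonpos h1.le (by omega) (by omega)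
    have hnn : n (k + 1) = n k + 1 := by omega
    have e1 := h.z_succ k h1.le (by omega)
    rw [hm] at e1
    rw [hm', hnn, pow_succ _ (n k)] at e4
    have hb0 : (0 : ℝ) < (1 / 2) ^ n k := by positivity
    have hb1 : ((1 : ℝ) / 2) ^ n k ≤ (1 / 2) ^ 1 := half_pow_le (by omega)
    have p1 := mul_pos hb0 hz
    have p2 := mul_nonneg hb0.le (sub_nonneg.2 hu)
    rcases e4 with e4 | e4 <;> linarith
  · have e1 := (h.of_type_one h1.le (by omega) hs1).1
    have e2 := (h.of_type_neg_one (k := k + 1) (by omega) (by omega) hs2).2.2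
    rw [show k + 1 + 1 = k + 2 by ring] at e2
    rcases e2 with e2 | e2 <;> linarith

end BlockChain

namespace BlockChain

variable {A B : ℤ} {m n : ℤ → ℕ} {z u : ℤ → ℝ}

/-! ### Chains with all types in `{-1, 0, 1}` -/

section SmallTypes

variable (h : BlockChain A B m n z u)
  (hs : ∀ k, A ≤ k → k ≤ B → -1 ≤ blockType m n k ∧ blockType m n k ≤ 1)

include h hs

omit h in
theorem type_cases {k : ℤ} (h1 : A ≤ k) (h2 : k ≤ B) :
    blockType m n k = -1 ∨ blockType m n k = 0 ∨ blockType m n k = 1 := by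
  have := hs k h1 h2; omega

theorem u_le_three_fourths {k : ℤ} (h1 : A ≤ k) (h2 : k ≤ B) : u k ≤ 3 / 4 := by
  have := h.u_le_one (k + 1)
  rcases type_cases hs h1 h2 with hk | hk | hk
  · linarith [(h.of_type_neg_one h1 h2 hk).2.1]
  · linarith [(h.of_type_zero h1 h2 hk).2]
  · linarith [(h.of_type_one h1 h2 hk).2.1]

theorem one_fourth_le_z {k : ℤ} (h1 : A < k) (h2 : k ≤ B + 1) : 1 / 4 ≤ z k := by
  have hz := h.z_nonneg (k - 1)
  rw [show k = k - 1 + 1 by ring]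
  rcases type_cases hs (k := k - 1) (by omega) (by omega) with hk | hk | hk
  · linarith [(h.of_type_neg_one (by omega) (by omega) hk).1]
  · linarith [(h.of_type_zero (by omega) (by omega) hk).1]
  · linarith [(h.of_type_one (by omega) (by omega) hk).1]

theorem u_le_of_type_le_zero {k : ℤ} (h1 : A ≤ k) (h2 : k + 1 ≤ B)
    (hk : blockType m n k ≤ 0) : u k ≤ 7 / 16 := by
  have := h.u_le_three_fourths hs (k := k + 1) (by omega) h2
  rcases type_cases hs h1 (by omega) with hk | hk | hk
  · linarith [(h.of_type_neg_one h1 (by omega) hk).2.1]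
  · linarith [(h.of_type_zero h1 (by omega) hk).2]
  · omega

/-- Two blocks of type one force `u (k + 2) ≥ 29/64`, above the bound `7/16` for types at most zero.
-/
theorem one_one_next {k : ℤ} (h1 : A ≤ k) (h2 : k + 3 ≤ B) (hk : blockType m n k = 1)
    (hk1 : blockType m n (k + 1) = 1) : blockType m n (k + 2) = 1 := by
  by_contra hc
  have hc' := hs (k + 2) (by omega) (by omega)
  have e1 := (h.of_type_one h1 (by omega) hk).1
  have e2 := (h.of_type_one (k := k + 1) (by omega) (by omega) hk1).2.2
  rw [show k + 1 + 1 = k + 2 by ring] at e2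
  have e3 := h.u_le_of_type_le_zero hs (k := k + 2) (by omega) (by omega) (by omega)
  linarith [h.z_nonneg k]

/-- A pair of types one would propagate to the right up to the descent at `J`. -/
theorem not_one_one {J : ℤ} (hJ : J + 2 ≤ B) (hd : blockType m n (J + 1) < blockType m n J)
    {k : ℤ} (h1 : A ≤ k) (h2 : k + 1 ≤ J) :
    ¬ (blockType m n k = 1 ∧ blockType m n (k + 1) = 1) := by
  intro hk
  have key : ∀ i, k ≤ i → i + 2 ≤ B → blockType m n i = 1 ∧ blockType m n (i + 1) = 1 := by
    intro i hi
    induction i, hi using Int.leInduction with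
    | base => exact fun _ => hk
    | succ i hi ih =>
      intro hB
      obtain ⟨i1, i2⟩ := ih (by omega)
      refine ⟨i2, ?_⟩
      rw [show i + 1 + 1 = i + 2 by ring]
      exact h.one_one_next hs (by omega) (by omega) i1 i2
  have := key J (by omega) hJ
  omega

variable (h11 : ∀ k, A ≤ k → k + 1 ≤ B → ¬ (blockType m n k = 1 ∧ blockType m n (k + 1) = 1))

include h11

/-- The worst case is a one followed by a type at most zero, which gives `5/8 + 7/128 = 87/128`;
`17/25` is a convenient larger number. -/
theorem u_le_of_not_one_one {k : ℤ} (h1 : A ≤ k) (h2 : k + 2 ≤ B) : u k ≤ 17 / 25 := by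
  rcases le_or_gt (blockType m n k) 0 with hk | hk
  · linarith [h.u_le_of_type_le_zero hs h1 (by omega) hk]
  · have hk1 : blockType m n k = 1 := by have := hs k h1 (by omega); omega
    have := h11 k h1 (by omega)
    have := hs (k + 1) (by omega) (by omega)
    have := h.u_le_of_type_le_zero hs (k := k + 1) (by omega) (by omega) (by omega)
    linarith [(h.of_type_one h1 (by omega) hk1).2.1]

/-- Type `-1` cannot follow: it would see `z (k + 1) ≥ 3/4`, while its condition with `u ≤ 17/25`
allows less than `0.68`. -/
theorem zero_of_one {k : ℤ} (h1 : A ≤ k) (h2 : k + 4 ≤ B) (hk : blockType m n k = 1) :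
    blockType m n (k + 1) = 0 := by
  have hne := h11 k h1 (by omega)
  rcases type_cases hs (k := k + 1) (by omega) (by omega) with hc | hc | hc
  · exfalso
    have e1 := (h.of_type_one h1 (by omega) hk).1
    have e2 := (h.of_type_neg_one (k := k + 1) (by omega) (by omega) hc).2.2
    rw [show k + 1 + 1 = k + 2 by ring] at e2
    have := h.u_le_of_not_one_one hs h11 (k := k + 2) (by omega) (by omega)
    have := h.z_nonneg k
    rcases e2 with e2 | e2 <;> linarith
  · exact hc
  · exact absurd ⟨hk, hc⟩ hne

omit h11 in
omit hs in
theorem cond_one_zero {k : ℤ} (h1 : A ≤ k) (h2 : k + 1 ≤ B) (hk : blockType m n k = 1)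
    (hk1 : blockType m n (k + 1) = 0) : 7 * z k ≤ 4 * u (k + 2) + 2 := by
  have e1 := (h.of_type_one h1 (by omega) hk).2.2
  have e2 := (h.of_type_zero (k := k + 1) (by omega) (by omega) hk1).2
  rw [show k + 1 + 1 = k + 2 by ring] at e2
  linarith

omit h11 in
omit hs in
theorem cond_zero_neg_one {k : ℤ} (h1 : A ≤ k) (h2 : k + 1 ≤ B) (hk : blockType m n k = 0)
    (hk1 : blockType m n (k + 1) = -1) :
    5 * z k ≤ 8 * u (k + 2) - 2 ∨ 7 * z k ≤ 16 * u (k + 2) - 6 := by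
  have e1 := (h.of_type_zero h1 (by omega) hk).1
  have e2 := (h.of_type_neg_one (k := k + 1) (by omega) (by omega) hk1).2.2
  rw [show k + 1 + 1 = k + 2 by ring] at e2
  rcases e2 with e2 | e2
  · left; linarith
  · right; linarith

/-- The condition at the one makes `u (k + 3)` too large for a type at most zero, so the pattern
continues as `0, 1, 0, 1, 0`. By then `z` has grown so far that the second one needs `u (k + 5) ≥
45/64`, beyond `17/25`. -/
theorem not_zero_one {k : ℤ} (h1 : A < k) (h2 : k + 7 ≤ B) (hk : blockType m n k = 0) :
    blockType m n (k + 1) ≠ 1 := by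
  intro hk1
  have e2 := h.zero_of_one hs h11 (k := k + 1) (by omega) (by omega) hk1
  have c1 := h.cond_one_zero (k := k + 1) (by omega) (by omega) hk1 e2
  have z1 := (h.of_type_zero h1.le (by omega) hk).1
  have z0 := h.one_fourth_le_z hs h1 (by omega)
  rw [show k + 1 + 2 = k + 3 by ring] at c1
  have e3 : blockType m n (k + 3) = 1 := by
    by_contra hc
    have := hs (k + 3) (by omega) (by omega)
    have := h.u_le_of_type_le_zero hs (k := k + 3) (by omega) (by omega) (by omega)
    linarith
  have e4 := h.zero_of_one hs h11 (k := k + 3) (by omega) (by omega) e3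
  have c3 := h.cond_one_zero (k := k + 3) (by omega) (by omega) e3 e4
  have z2 := (h.of_type_one (k := k + 1) (by omega) (by omega) hk1).1
  have z3 := (h.of_type_zero (k := k + 1 + 1) (by omega) (by omega) e2).1
  rw [show k + 3 + 2 = k + 5 by ring] at c3
  rw [show k + 1 + 1 + 1 = k + 3 by ring] at z3
  have := h.u_le_of_not_one_one hs h11 (k := k + 5) (by omega) (by omega)
  have := h.z_nonneg (k + 1)
  linarith

/-- A second negative type is excluded by `nonneg_after_descent`. A zero at `k + 2` would give `u (k
+ 2) ≤ 23/64`, whereas `z k ≥ 1/4` requires at least `26/64`. -/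
theorem one_of_zero_neg_one {k : ℤ} (h1 : A < k) (h2 : k + 9 ≤ B) (hk : blockType m n k = 0)
    (hk1 : blockType m n (k + 1) = -1) : blockType m n (k + 2) = 1 := by
  have hnn := h.nonneg_after_descent h1 (by omega) (by omega) hk1.le
  rcases type_cases hs (k := k + 2) (by omega) (by omega) with hc | hc | hc
  · omega
  · exfalso
    have e2 := (h.of_type_zero (k := k + 2) (by omega) (by omega) hc).2
    rw [show k + 2 + 1 = k + 3 by ring] at e2
    have e3 := h.not_zero_one hs h11 (k := k + 2) (by omega) (by omega) hc
    rw [show k + 2 + 1 = k + 3 by ring] at e3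
    have := hs (k + 3) (by omega) (by omega)
    have := h.u_le_of_type_le_zero hs (k := k + 3) (by omega) (by omega) (by omega)
    have := h.one_fourth_le_z hs h1 (by omega)
    rcases h.cond_zero_neg_one h1.le (by omega) hk hk1 with c | c <;> linarith
  · exact hc

/-- The first descent pushes `z` above `2/3`, the next occurrence of `0, -1` turns this into `u >
1/3`, and from there on only type zero is possible, which leaves no room for a third descent. -/
theorem false_of_descents_of_not_one_one {J₁ J₂ J₃ : ℤ} (h1 : A < J₁) (h12 : J₁ + 4 ≤ J₂)
    (h23 : J₂ + 4 ≤ J₃) (h3 : J₃ + 9 ≤ B) (hd1 : blockType m n (J₁ + 1) < blockType m n J₁)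
    (hd2 : blockType m n (J₂ + 1) < blockType m n J₂)
    (hd3 : blockType m n (J₃ + 1) < blockType m n J₃) : False := by
  have step1 : ∃ i, J₁ < i ∧ i ≤ J₁ + 3 ∧ blockType m n i = 0 ∧ 2 / 3 < z i := by
    rcases type_cases hs (k := J₁) (by omega) (by omega) with hc | hc | hc
    · have := hs (J₁ + 1) (by omega) (by omega)
      omega
    · have e1 : blockType m n (J₁ + 1) = -1 := by
        have := hs (J₁ + 1) (by omega) (by omega); omega
      have e2 := h.one_of_zero_neg_one hs h11 h1 (by omega) hc e1
      have e3 := h.zero_of_one hs h11 (k := J₁ + 2) (by omega) (by omega) e2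
      have e4 := (h.of_type_one (k := J₁ + 2) (by omega) (by omega) e2).1
      rw [show J₁ + 2 + 1 = J₁ + 3 by ring] at e3 e4
      exact ⟨J₁ + 3, by omega, by omega, e3, by linarith [h.z_nonneg (J₁ + 2)]⟩
    · have e1 := h.zero_of_one hs h11 (k := J₁) (by omega) (by omega) hc
      have e2 := (h.of_type_one (k := J₁) (by omega) (by omega) hc).1
      exact ⟨J₁ + 1, by omega, by omega, e1, by linarith [h.z_nonneg J₁]⟩
  obtain ⟨i, hi1, hi2, hi3, hi4⟩ := step1
  -- Type zero preserves `z > 2/3` and is not followed by one; so the zeros continue until a `-1`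
  -- appears, at the latest at the second descent.
  have step2 : ∃ k, i ≤ k ∧ k ≤ J₂ ∧ blockType m n k = 0 ∧ blockType m n (k + 1) = -1 ∧
      2 / 3 < z k := by
    by_contra! hc
    have key : ∀ k, i ≤ k → k ≤ J₂ → blockType m n k = 0 ∧ 2 / 3 < z k := by
      intro k hk
      induction k, hk using Int.leInduction with
      | base => exact fun _ => ⟨hi3, hi4⟩
      | succ k hk ih =>
        intro hkJ
        obtain ⟨i1, i2⟩ := ih (by omega)
        have n1 : blockType m n (k + 1) ≠ -1 := fun hc' => by
          linarith [hc k hk (by omega) i1 hc']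
        have n2 := h.not_zero_one hs h11 (k := k) (by omega) (by omega) i1
        have := hs (k + 1) (by omega) (by omega)
        refine ⟨by omega, ?_⟩
        linarith [(h.of_type_zero (k := k) (by omega) (by omega) i1).1]
    obtain ⟨i1, i2⟩ := key J₂ (by omega) le_rfl
    have := hs (J₂ + 1) (by omega) (by omega)
    linarith [hc J₂ (by omega) le_rfl i1 (by omega)]
  obtain ⟨k, hk1, hk2, hk3, hk4, hk5⟩ := step2
  have e1 := h.one_of_zero_neg_one hs h11 (k := k) (by omega) (by omega) hk3 hk4
  have e2 := h.zero_of_one hs h11 (k := k + 2) (by omega) (by omega) e1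
  -- Both lines defining the lower sides give exactly `2/3` here when `z k = 2/3`.
  have e3 : 2 / 3 < u (k + 2) := by
    rcases h.cond_zero_neg_one (k := k) (by omega) (by omega) hk3 hk4 with c | c <;> linarith
  have e4 := (h.of_type_one (k := k + 2) (by omega) (by omega) e1).2.1
  -- Read forwards, type zero sends `u` to `4 * u - 1`, which preserves `u > 1/3`; negative types
  -- have `u ≤ 1/4`.
  have key : ∀ j, k + 3 ≤ j → j ≤ J₃ + 1 → blockType m n j = 0 ∧ 1 / 3 < u j := by
    intro j hj
    induction j, hj using Int.leInduction with
    | base =>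
      intro _
      rw [show k + 2 + 1 = k + 3 by ring] at e2 e4
      exact ⟨e2, by linarith⟩
    | succ j hj ih =>
      intro hjJ
      obtain ⟨i1, i2⟩ := ih (by omega)
      have e5 := (h.of_type_zero (k := j) (by omega) (by omega) i1).2
      have n2 := h.not_zero_one hs h11 (k := j) (by omega) (by omega) i1
      have := hs (j + 1) (by omega) (by omega)
      have n1 : ¬ blockType m n (j + 1) ≤ -1 := fun hc' => by
        linarith [h.u_le_of_type_neg (k := j + 1) (by omega) (by omega) hc']
      exact ⟨by omega, by linarith⟩
  have k1 := key J₃ (by omega) (by omega)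
  have k2 := key (J₃ + 1) (by omega) (by omega)
  omega

end SmallTypes

/-- A chain has boundedly many descents. -/
theorem false_of_descents (h : BlockChain A B m n z u) (J : ℕ → ℤ) (hA : A < J 0)
    (hB : J 7 + 2 ≤ B) (hJ : ∀ i < 7, J i + 12 ≤ J (i + 1))
    (hd : ∀ i ≤ 7, blockType m n (J i + 1) < blockType m n (J i)) : False := by
  have j0 := hJ 0 (by norm_num)
  have j1 := hJ 1 (by norm_num)
  have j2 := hJ 2 (by norm_num)
  have j3 := hJ 3 (by norm_num)
  have j4 := hJ 4 (by norm_num)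
  have j5 := hJ 5 (by norm_num)
  have j6 := hJ 6 (by norm_num)
  norm_num at j0 j1 j2 j3 j4 j5 j6
  -- A type of at least two stays so until a descent, and that descent would be the last one. The
  -- descents at `J 6` and `J 7` rule this out.
  have hup : ∀ k, A ≤ k → k ≤ J 6 → blockType m n k ≤ 1 := by
    intro k hk1 hk2
    by_contra! hc
    have key : ∀ i, k ≤ i → i ≤ J 6 → 2 ≤ blockType m n i := by
      intro i hi
      induction i, hi using Int.leInduction with
      | base => intro _; omega
      | succ i hi ih =>
        intro hiJ
        have i1 := ih (by omega)
        by_contra! hc'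
        have := h.no_descent_after (k := i) (by omega) (by omega) (by omega) i1 (j := J 6)
          (by omega) (by omega)
        have := hd 6 (by norm_num)
        omega
    have := h.no_descent_after (k := J 6) (by omega) (by omega) (hd 6 (by norm_num))
      (key _ hk2 le_rfl) (j := J 7) (by omega) (by omega)
    have := hd 7 (by norm_num)
    omega
  have hstart : ∃ i, J 0 < i ∧ i ≤ J 0 + 2 ∧ 0 ≤ blockType m n i := by
    by_cases hc : 0 ≤ blockType m n (J 0 + 1)
    · exact ⟨J 0 + 1, by omega, by omega, hc⟩
    · exact ⟨J 0 + 2, by omega, by omega,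
        h.nonneg_after_descent hA (by omega) (hd 0 (by norm_num)) (by omega)⟩
  obtain ⟨i, hi1, hi2, hi3⟩ := hstart
  -- From a nonnegative type a descent reaches at worst `-1`, and the type is nonnegative right
  -- afterwards.
  have hlow : ∀ k, i ≤ k → k + 1 ≤ B - 1 → 0 ≤ blockType m n k ∨
      (blockType m n k = -1 ∧ 0 ≤ blockType m n (k + 1)) := by
    intro k hk
    induction k, hk using Int.leInduction with
    | base => exact fun _ => Or.inl hi3
    | succ k hk ih =>
      intro hkB
      rcases ih (by omega) with hc | hc
      · by_cases hc' : 0 ≤ blockType m n (k + 1)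
        · exact Or.inl hc'
        · right
          have hlt : blockType m n (k + 1) < blockType m n k := by omega
          have := h.descent_step (k := k) (by omega) (by omega) hlt
          have := h.nonneg_after_descent (k := k) (by omega) (by omega) hlt (by omega)
          rw [show k + 1 + 1 = k + 2 by ring]
          omega
      · exact Or.inl hc.2
  have hmono := h.mono (A' := i) (B' := J 6) (by omega) (by omega)
  have hs : ∀ k, i ≤ k → k ≤ J 6 → -1 ≤ blockType m n k ∧ blockType m n k ≤ 1 := by
    intro k hk1 hk2
    have := hlow k hk1 (by omega)
    have := hup k (by omega) hk2
    omega
  have h11 : ∀ k, i ≤ k → k + 1 ≤ J 5 →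
      ¬ (blockType m n k = 1 ∧ blockType m n (k + 1) = 1) := fun k hk1 hk2 =>
    hmono.not_one_one hs (J := J 5) (by omega) (hd 5 (by norm_num)) hk1 hk2
  exact (hmono.mono (A' := i) (B' := J 5) le_rfl (by omega)).false_of_descents_of_not_one_one
    (fun k hk1 hk2 => hs k hk1 (by omega)) h11 (J₁ := J 2) (J₂ := J 3) (J₃ := J 4) (by omega)
    (by omega) (by omega) (by omega) (hd 2 (by norm_num)) (hd 3 (by norm_num))
    (hd 4 (by norm_num))

end BlockChain

/-! ### Block decomposition of bi-infinite sequences -/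

/-- The letters of `s` at the positions `e` and `e + 1` are `0` and `1`. -/
def IsAscent (s : ℤ → Fin 2) (e : ℤ) : Prop := s e = 0 ∧ s (e + 1) = 1

/-- The position `e` carries a zero and is followed by `1^m 0^n`. -/
structure IsBlock (s : ℤ → Fin 2) (e : ℤ) (m n : ℕ) : Prop where
  one_le_m : 1 ≤ m
  one_le_n : 1 ≤ n
  start : s e = 0
  ones : ∀ j, e < j → j ≤ e + m → s j = 1
  zeros : ∀ j, e + m < j → j ≤ e + m + n → s j = 0

/-- After the ones that follow `e` have ended, a new one could only appear through an ascent, so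
zeros fill the rest up to `e'`. -/
theorem exists_isBlock {s : ℤ → Fin 2} {e e' : ℤ} (h : e < e') (he : IsAscent s e)
    (he' : IsAscent s e') (hno : ∀ j, e < j → j < e' → ¬ IsAscent s j) :
    ∃ m n : ℕ, e' = e + m + n ∧ IsBlock s e m n := by
  have hex : ∃ m : ℕ, s (e + m + 1) = 0 := by
    refine ⟨(e' - e - 1).toNat, ?_⟩
    rw [Int.toNat_of_nonneg (by omega)]
    convert he'.1 using 2; ring
  classical
  have hm := Nat.find_spec hex
  have hmin : ∀ i < Nat.find hex, s (e + i + 1) = 1 := fun i hi => by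
    have := Nat.find_min hex hi
    omega
  generalize Nat.find hex = M at hm hmin
  have hM1 : 1 ≤ M := by
    by_contra! hc
    obtain rfl : M = 0 := by omega
    have := he.2
    simp at hm
    omega
  have hMe : e + M + 1 ≤ e' := by
    by_contra! hc
    have := hmin (e' - e - 1).toNat (by omega)
    rw [Int.toNat_of_nonneg (by omega), show e + (e' - e - 1) + 1 = e' by ring, he'.1] at this
    omega
  have hz : ∀ j, e + M + 1 ≤ j → j ≤ e' → s j = 0 := by
    intro j hj
    induction j, hj using Int.leInduction with
    | base => exact fun _ => hm
    | succ j hj ih =>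
      intro hj'
      have h0 := ih (by omega)
      by_contra hc
      exact hno j (by omega) (by omega) ⟨h0, by omega⟩
  refine ⟨M, (e' - e - M).toNat, by omega, hM1, by omega, he.1, fun j h1 h2 => ?_,
    fun j h1 h2 => hz j (by omega) (by omega)⟩
  have := hmin (j - e - 1).toNat (by omega)
  rwa [Int.toNat_of_nonneg (by omega), show e + (j - e - 1) + 1 = j by ring] at this

/-- All points of the orbit of `s` are outside the quadrilateral `deltaPrime`, given by
inequalities. -/
def AvoidsPrime (s : ℤ → Fin 2) : Prop :=
  ∀ i, ¬ (0 < rightValue s i ∧ leftValue s i < 1 ∧ 1 / 2 + 4 / 5 * rightValue s i < leftValue s i ∧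
    3 / 7 + 8 / 7 * rightValue s i < leftValue s i)

/-- Consecutive blocks at the positions `e k`, for `A ≤ k ≤ B`. -/
def BlocksOn (s : ℤ → Fin 2) (e : ℤ → ℤ) (m n : ℤ → ℕ) (A B : ℤ) : Prop :=
  ∀ k, A ≤ k → k ≤ B → IsBlock s (e k) (m k) (n k) ∧ e (k + 1) = e k + m k + n k

/-- One more block than in the chain is required, because the zeros of block `B` are known to stop
only through the first one of block `B + 1`. -/
theorem BlocksOn.blockChain {s : ℤ → Fin 2} (hs : AvoidsPrime s) {e : ℤ → ℤ} {m n : ℤ → ℕ}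
    {A B : ℤ} (h : BlocksOn s e m n A (B + 1)) :
    BlockChain A B m n (fun k => leftValue s (e k - 1)) (fun k => rightValue s (e k + 1)) := by
  have hy : ∀ k, A ≤ k → k ≤ B → leftValue s (e k + m k) =
      1 - (1 / 2) ^ m k + (1 / 2) ^ m k * leftValue s (e k - 1) / 2 := by
    intro k h1 h2
    obtain ⟨hb, -⟩ := h k h1 (by omega)
    rw [leftValue_of_ones (n := m k) fun j j1 j2 => hb.ones j (by omega) j2, add_sub_cancel_right,
      leftValue_step s (e k), hb.start]
    norm_num; ring
  have hx' : ∀ k, A ≤ k → k ≤ B → rightValue s (e k + m k) =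
      (1 / 2) ^ n k * rightValue s (e (k + 1)) := by
    intro k h1 h2
    obtain ⟨hb, he⟩ := h k h1 (by omega)
    rw [rightValue_of_zeros (n := n k) hb.zeros, he]
  have hx : ∀ k, A ≤ k → k ≤ B → rightValue s (e k + m k) =
      (1 / 2) ^ n k * (1 + rightValue s (e (k + 1) + 1)) / 2 := by
    intro k h1 h2
    obtain ⟨hb', -⟩ := h (k + 1) (by omega) (by omega)
    rw [hx' k h1 h2, rightValue_step s (e (k + 1)),
      hb'.ones (e (k + 1) + 1) (by omega) (by have := hb'.one_le_m; omega)]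
    norm_num; ring
  refine ⟨fun k h1 h2 => (h k h1 (by omega)).1.one_le_m,
    fun k h1 h2 => (h k h1 (by omega)).1.one_le_n, fun k => leftValue_nonneg _ _,
    fun k => leftValue_le_one _ _, fun k => rightValue_nonneg _ _, fun k => rightValue_le_one _ _,
    fun k h1 h2 => ?_, fun k h1 h2 => ?_, fun k h1 h2 => ?_⟩
  · obtain ⟨hb, he⟩ := h k h1 (by omega)
    obtain ⟨hb', -⟩ := h (k + 1) (by omega) (by omega)
    have e1 : leftValue s (e (k + 1)) = (1 / 2) ^ n k * leftValue s (e k + m k) := by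
      rw [leftValue_of_zeros (n := n k) fun j j1 j2 => hb.zeros j (by omega) (by omega), he,
        add_sub_cancel_right]
    have e2 := leftValue_step s (e (k + 1))
    rw [hb'.start, e1, hy k h1 h2] at e2
    norm_num at e2 ⊢
    linarith
  · obtain ⟨hb, he⟩ := h k h1 (by omega)
    have e1 := rightValue_of_ones (s := s) (i := e k) (n := m k) hb.ones
    have e2 := rightValue_step s (e k)
    rw [hb.ones (e k + 1) (by omega) (by have := hb.one_le_m; omega), e1, hx k h1 h2] at e2
    norm_num at e2 ⊢
    linarith
  · have hav := hs (e k + m k)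
    rw [hx k h1 h2, hy k h1 h2] at hav
    obtain ⟨hb, he⟩ := h k h1 (by omega)
    have ha : (0 : ℝ) < (1 / 2) ^ m k := by positivity
    have hbp : (0 : ℝ) < (1 / 2) ^ n k := by positivity
    have p1 : 0 < (1 / 2 : ℝ) ^ n k * (1 + rightValue s (e (k + 1) + 1)) :=
      mul_pos hbp (by linarith [rightValue_nonneg s (e (k + 1) + 1)])
    have p2 := mul_nonneg ha.le (sub_nonneg.2 (leftValue_le_one s (e k - 1)))
    by_contra! hc
    exact hav ⟨by linarith, by linarith, hc.1, hc.2⟩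

/-! ### The tails of avoiding sequences -/

/-- For every `L`, the sequence is eventually periodic, or one of its letters eventually occurs at
most once in every window of length `L + 1`. -/
def TailSmall (d : ℕ → Fin 2) : Prop :=
  ∀ L : ℕ, (∃ p N, 1 ≤ p ∧ ∀ k, N ≤ k → d (k + p) = d k) ∨
    ∃ c N, ∀ k, N ≤ k → d k = c → ∀ i, 1 ≤ i → i ≤ L → d (k + i) ≠ c

theorem TailSmall.of_eventually_const {d : ℕ → Fin 2} {N : ℕ} {c : Fin 2}
    (h : ∀ k, N ≤ k → d k = c) : TailSmall d := fun _ =>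
  Or.inl ⟨1, N, le_rfl, fun k hk => by rw [h k hk, h (k + 1) (by omega)]⟩

theorem TailSmall.complement {d : ℕ → Fin 2} (h : TailSmall d) :
    TailSmall (fun k => 1 - d k) := by
  intro L
  rcases h L with ⟨p, N, hp, hN⟩ | ⟨c, N, hN⟩
  · exact Or.inl ⟨p, N, hp, fun k hk => by beta_reduce; rw [hN k hk]⟩
  · refine Or.inr ⟨1 - c, N, fun k hk hc i h1 h2 hi => ?_⟩
    have hinj : ∀ a b : Fin 2, 1 - a = 1 - b → a = b := by decide
    exact hN k hk (hinj _ _ hc) i h1 h2 (hinj _ _ (by simpa using hi))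

/-- A map on the integers that is eventually nondecreasing is eventually constant or tends to
infinity. -/
theorem eventually_const_or_tendsto {f : ℤ → ℤ} {K : ℤ} (h : ∀ k, K ≤ k → f k ≤ f (k + 1)) :
    (∃ c K', K ≤ K' ∧ ∀ k, K' ≤ k → f k = c) ∨ ∀ j, ∃ K', K ≤ K' ∧ ∀ k, K' ≤ k → j ≤ f k := by
  have hmono : ∀ a, K ≤ a → ∀ b, a ≤ b → f a ≤ f b := by
    intro a ha b hb
    induction b, hb using Int.leInduction with
    | base => exact le_rfl
    | succ b hb ih => exact ih.trans (h b (by omega))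
  by_cases hc : ∀ j, ∃ K', K ≤ K' ∧ j ≤ f K'
  · right
    intro j
    obtain ⟨K', h1, h2⟩ := hc j
    exact ⟨K', h1, fun k hk => h2.trans (hmono K' h1 k hk)⟩
  · left
    push Not at hc
    obtain ⟨j, hj⟩ := hc
    obtain ⟨c, ⟨K', h1, h2⟩, h3⟩ := Int.exists_greatest_of_bdd
      (P := fun v => ∃ k, K ≤ k ∧ f k = v) ⟨j, fun v ⟨k, hk, hv⟩ => by
        have := hj k hk; omega⟩ ⟨f K, K, le_rfl, rfl⟩
    exact ⟨c, K', h1, fun k hk => le_antisymm (h3 _ ⟨k, by omega, rfl⟩)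
      (h2 ▸ hmono K' h1 k hk)⟩

theorem BlockChain.eq_of_blockType_eq {A B : ℤ} {m n : ℤ → ℕ} {z u : ℤ → ℝ}
    (h : BlockChain A B m n z u) {k k' : ℤ} (h1 : A ≤ k) (h2 : k ≤ B) (h1' : A ≤ k') (h2' : k' ≤ B)
    (hq : blockType m n k = blockType m n k') : m k = m k' ∧ n k = n k' := by
  have := h.one_or_one h1 h2
  have := h.one_or_one h1' h2'
  have := h.one_le_m k h1 h2
  have := h.one_le_n k h1 h2
  have := h.one_le_m k' h1' h2'
  have := h.one_le_n k' h1' h2'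
  unfold blockType at hq
  omega

/-- The letters of a block determine those of a block of the same shape. -/
theorem IsBlock.eq_of_isBlock {s : ℤ → Fin 2} {e e' : ℤ} {m n : ℕ} (h : IsBlock s e m n)
    (h' : IsBlock s e' m n) {i : ℤ} (h1 : e < i) (h2 : i ≤ e + m + n) :
    s (i + (e' - e)) = s i := by
  rcases le_or_gt i (e + m) with hi | hi
  · rw [h.ones i h1 hi, h'.ones _ (by omega) (by omega)]
  · rw [h.zeros i hi h2, h'.zeros _ (by omega) (by omega)]

section Right

variable {s : ℤ → Fin 2}

theorem exists_blocks_right (hinf : ∀ N : ℕ, ∃ k, N ≤ k ∧ IsAscent s (k : ℤ)) :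
    ∃ (e : ℤ → ℤ) (m n : ℤ → ℕ), 0 ≤ e 0 ∧ ∀ B, BlocksOn s e m n 0 B := by
  set p : ℕ → Prop := fun k => IsAscent s (k : ℤ)
  have hp : (Set.ofPred p).Infinite := by
    rw [Set.infinite_iff_exists_gt]
    intro a
    obtain ⟨k, hk, hk'⟩ := hinf (a + 1)
    exact ⟨k, hk', hk⟩
  have hex : ∀ k : ℤ, ∃ m n : ℕ, 0 ≤ k →
      IsBlock s (Nat.nth p k.toNat) m n ∧
        (Nat.nth p (k + 1).toNat : ℤ) = Nat.nth p k.toNat + m + n := by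
    intro k
    by_cases hk : 0 ≤ k
    · have hk1 : (k + 1).toNat = k.toNat + 1 := by omega
      have hlt := (Nat.nth_lt_nth hp).2 (Nat.lt_succ_self k.toNat)
      obtain ⟨m, n, h1, h2⟩ := exists_isBlock (s := s) (e := (Nat.nth p k.toNat : ℤ))
        (e' := (Nat.nth p (k.toNat + 1) : ℤ)) (by exact_mod_cast hlt)
        (Nat.nth_mem_of_infinite hp _) (Nat.nth_mem_of_infinite hp _) (by
          intro j j1 j2 hj
          have hj0 : ((j.toNat : ℕ) : ℤ) = j := Int.toNat_of_nonneg (by omega)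
          have : p j.toNat := by simp only [p]; rwa [hj0]
          have := Nat.le_nth_of_lt_nth_succ (k := k.toNat) (by omega) this
          omega)
      exact ⟨m, n, fun _ => ⟨h2, by rw [hk1]; exact h1⟩⟩
    · exact ⟨0, 0, fun h => absurd h hk⟩
  choose m n hmn using hex
  exact ⟨fun k => Nat.nth p k.toNat, m, n, by positivity, fun B k h1 _ => hmn k h1⟩

/-- Otherwise descents occur arbitrarily far out, and eight of them can be chosen with the gaps that
`BlockChain.false_of_descents` requires. -/
theorem eventually_le_right (hs : AvoidsPrime s) {e : ℤ → ℤ} {m n : ℤ → ℕ}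
    (hb : ∀ B, BlocksOn s e m n 0 B) :
    ∃ K, 0 ≤ K ∧ ∀ k, K ≤ k → blockType m n k ≤ blockType m n (k + 1) := by
  by_contra! hc
  have hc' : ∀ K : ℤ, ∃ k, K ≤ k ∧ 0 ≤ k ∧ blockType m n (k + 1) < blockType m n k := by
    intro K
    obtain ⟨k, h1, h2⟩ := hc (max K 0) (le_max_right _ _)
    exact ⟨k, (le_max_left _ _).trans h1, (le_max_right _ _).trans h1, h2⟩
  choose f hf using hc'
  set J : ℕ → ℤ := fun i => Nat.rec (f 1) (fun _ j => f (j + 12)) i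
  have hJ : ∀ i, J i + 12 ≤ J (i + 1) := fun i => (hf (J i + 12)).1
  refine ((hb (J 7 + 2 + 1)).blockChain hs).false_of_descents J ?_ le_rfl (fun i _ => hJ i) ?_
  · have : 1 ≤ J 0 := (hf 1).1
    omega
  · intro i _
    cases i with
    | zero => exact (hf 1).2.2
    | succ i => exact (hf (J i + 12)).2.2

theorem exists_block_right {e : ℤ → ℤ} {m n : ℤ → ℕ} (hb : ∀ B, BlocksOn s e m n 0 B) {K : ℤ}
    (hK : 0 ≤ K) {i : ℤ} (hi : e K < i) : ∃ k, K ≤ k ∧ e k < i ∧ i ≤ e (k + 1) := by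
  induction i, (show e K + 1 ≤ i by omega) using Int.leInduction with
  | base =>
    obtain ⟨h1, h2⟩ := hb K K hK le_rfl
    have := h1.one_le_m
    exact ⟨K, le_rfl, by omega, by omega⟩
  | succ i hi' ih =>
    obtain ⟨k, h1, h2, h3⟩ := ih (by omega)
    by_cases hc : i + 1 ≤ e (k + 1)
    · exact ⟨k, h1, by omega, hc⟩
    · obtain ⟨h4, h5⟩ := hb (k + 1) (k + 1) (by omega) le_rfl
      have := h4.one_le_m
      exact ⟨k + 1, by omega, by omega, by omega⟩

/-- With finitely many ascents the tail is constant. Otherwise the types are eventually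
nondecreasing: if eventually constant, the same block repeats; if they tend to infinity, the blocks
are `1^m 0` with `m > L` and the zeros are isolated. -/
theorem tailSmall_right (hs : AvoidsPrime s) : TailSmall (fun k : ℕ => s (k + 1)) := by
  by_cases hinf : ∀ N : ℕ, ∃ k, N ≤ k ∧ IsAscent s (k : ℤ)
  swap
  · push Not at hinf
    obtain ⟨N, hN⟩ := hinf
    by_cases h1 : ∃ j : ℕ, N ≤ j ∧ s j = 0
    · obtain ⟨j, hj, hj0⟩ := h1
      refine TailSmall.of_eventually_const (N := j) (c := 0) ?_
      have key : ∀ k : ℕ, j ≤ k → s k = 0 := by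
        intro k hk
        induction k, hk using Nat.le_induction with
        | base => exact hj0
        | succ k hk ih =>
          by_contra hc
          exact hN k (by omega) ⟨ih, by push_cast at hc; omega⟩
      intro k hk
      exact_mod_cast key (k + 1) (by omega)
    · push Not at h1
      refine TailSmall.of_eventually_const (N := N) (c := 1) fun k hk => ?_
      have := h1 (k + 1) (by omega)
      push_cast at this
      omega
  obtain ⟨e, m, n, he0, hb⟩ := exists_blocks_right hinf
  obtain ⟨K, hK0, hK⟩ := eventually_le_right hs hb
  have hchain := fun B => (hb (B + 1)).blockChain hs
  have hepos : ∀ k, 0 ≤ k → 0 ≤ e k := by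
    intro k hk
    induction k, hk using Int.leInduction with
    | base => exact he0
    | succ k hk ih =>
      have := (hb k k hk le_rfl).2
      omega
  intro L
  rcases eventually_const_or_tendsto hK with ⟨c, K', hK', hc⟩ | hc
  · left
    have hmn : ∀ k, K' ≤ k → m k = m K' ∧ n k = n K' := fun k hk =>
      (hchain k).eq_of_blockType_eq (by omega) le_rfl (by omega) hk
        (by rw [hc k hk, hc K' le_rfl])
    have hpos := (hb K' K' (by omega) le_rfl).1.one_le_m
    have := hepos K' (by omega)
    refine ⟨m K' + n K', (e K').toNat, by omega, fun i hi => ?_⟩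
    obtain ⟨k, h1, h2, h3⟩ := exists_block_right hb (K := K') (i := i + 1) (by omega) (by omega)
    obtain ⟨hb1, he1⟩ := hb k k (by omega) le_rfl
    obtain ⟨hb2, -⟩ := hb (k + 1) (k + 1) (by omega) le_rfl
    obtain ⟨hm1, hn1⟩ := hmn k h1
    obtain ⟨hm2, hn2⟩ := hmn (k + 1) (by omega)
    rw [hm1, hn1] at hb1 he1
    rw [hm2, hn2] at hb2
    beta_reduce
    rw [← hb1.eq_of_isBlock hb2 h2 (by omega)]
    congr 1
    push_cast
    omega
  · right
    obtain ⟨K', hK', hq⟩ := hc L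
    have := hepos K' (by omega)
    refine ⟨0, (e K').toNat, fun i hi hi0 j hj1 hj2 => ?_⟩
    obtain ⟨k, h1, h2, h3⟩ := exists_block_right hb (K := K') (i := i + 1) (by omega) (by omega)
    obtain ⟨hb1, he1⟩ := hb k k (by omega) le_rfl
    obtain ⟨hb2, -⟩ := hb (k + 1) (k + 1) (by omega) le_rfl
    obtain ⟨hn, hm⟩ := (hchain k).type_nonneg (k := k) (by omega) le_rfl
      (by have := hq k h1; omega)
    obtain ⟨hn', hm'⟩ := (hchain (k + 1)).type_nonneg (k := k + 1) (by omega) le_rfl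
      (by have := hq (k + 1) (by omega); omega)
    have hend : (i : ℤ) + 1 = e (k + 1) := by
      by_contra hne
      have := hb1.ones (i + 1) h2 (by omega)
      simp only at hi0
      omega
    have := hq (k + 1) (by omega)
    have := hb2.ones (i + j + 1) (by omega) (by omega)
    simp only [Nat.cast_add]
    omega

end Right

section Left

variable {s : ℤ → Fin 2}

theorem exists_blocks_left (hinf : ∀ N : ℕ, ∃ k, N ≤ k ∧ IsAscent s (-k : ℤ)) :
    ∃ (e : ℤ → ℤ) (m n : ℤ → ℕ), e 0 ≤ 0 ∧ ∀ A, BlocksOn s e m n A (-1) := by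
  set p : ℕ → Prop := fun k => IsAscent s (-k : ℤ)
  have hp : (Set.ofPred p).Infinite := by
    rw [Set.infinite_iff_exists_gt]
    intro a
    obtain ⟨k, hk, hk'⟩ := hinf (a + 1)
    exact ⟨k, hk', hk⟩
  have hex : ∀ k : ℤ, ∃ m n : ℕ, k ≤ -1 →
      IsBlock s (-(Nat.nth p (-k).toNat : ℤ)) m n ∧
        -(Nat.nth p (-(k + 1)).toNat : ℤ) = -(Nat.nth p (-k).toNat : ℤ) + m + n := by
    intro k
    by_cases hk : k ≤ -1
    · have hk1 : (-k).toNat = (-(k + 1)).toNat + 1 := by omega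
      have hlt := (Nat.nth_lt_nth hp).2 (Nat.lt_succ_self (-(k + 1)).toNat)
      obtain ⟨m, n, h1, h2⟩ := exists_isBlock (s := s)
        (e := (-(Nat.nth p ((-(k + 1)).toNat + 1) : ℤ)))
        (e' := (-(Nat.nth p (-(k + 1)).toNat : ℤ))) (by simpa using hlt)
        (Nat.nth_mem_of_infinite hp _) (Nat.nth_mem_of_infinite hp _) (by
          intro j j1 j2 hj
          have hj0 : -(((-j).toNat : ℕ) : ℤ) = j := by omega
          have : p (-j).toNat := by simp only [p]; rwa [hj0]
          have := Nat.le_nth_of_lt_nth_succ (k := (-(k + 1)).toNat) (by omega) this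
          omega)
      exact ⟨m, n, fun _ => by rw [hk1]; exact ⟨h2, h1⟩⟩
    · exact ⟨0, 0, fun h => absurd h hk⟩
  choose m n hmn using hex
  exact ⟨fun k => -(Nat.nth p (-k).toNat : ℤ), m, n, by simp, fun A k _ h1 => hmn k h1⟩

theorem eventually_le_left (hs : AvoidsPrime s) {e : ℤ → ℤ} {m n : ℤ → ℕ}
    (hb : ∀ A, BlocksOn s e m n A (-1)) :
    ∃ K, K ≤ -2 ∧ ∀ k, k ≤ K → blockType m n (k - 1) ≤ blockType m n k := by
  by_contra! hc
  have hc' : ∀ K : ℤ, ∃ k, k ≤ K ∧ blockType m n (k + 1) < blockType m n k := by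
    intro K
    obtain ⟨k, h1, h2⟩ := hc (min K (-2)) (min_le_right _ _)
    exact ⟨k - 1, by have := min_le_left K (-2); omega, by rwa [sub_add_cancel]⟩
  choose f hf using hc'
  set J : ℕ → ℤ := fun i => Nat.rec (f (-10)) (fun _ j => f (j - 12)) i
  have hJ : ∀ i, J (i + 1) ≤ J i - 12 := fun i => (hf (J i - 12)).1
  have hchain := (hb (J 7 - 1)).blockChain (B := -2) hs
  refine hchain.false_of_descents (fun i => J (7 - i)) ?_ ?_ ?_ ?_
  · simp
  · have : J 0 ≤ -10 := (hf (-10)).1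
    simp only [Nat.sub_self]
    omega
  · intro i hi
    have := hJ (7 - (i + 1))
    rw [show 7 - (i + 1) + 1 = 7 - i by omega] at this
    omega
  · intro i _
    cases 7 - i with
    | zero => exact (hf (-10)).2
    | succ i => exact (hf (J i - 12)).2

theorem exists_block_left {e : ℤ → ℤ} {m n : ℤ → ℕ} (hb : ∀ A, BlocksOn s e m n A (-1)) {K : ℤ}
    (hK : K ≤ 0) {i : ℤ} (hi : i ≤ e K) : ∃ k, k < K ∧ e k < i ∧ i ≤ e (k + 1) := by
  induction i, hi using Int.leInductionDown with
  | base =>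
    obtain ⟨h1, h2⟩ := hb (K - 1) (K - 1) le_rfl (by omega)
    have := h1.one_le_m
    exact ⟨K - 1, by omega, by rw [sub_add_cancel] at h2; omega, by rw [sub_add_cancel]⟩
  | pred i hi' ih =>
    obtain ⟨k, h1, h2, h3⟩ := ih
    by_cases hc : e k < i - 1
    · exact ⟨k, h1, by omega, by omega⟩
    · obtain ⟨h4, h5⟩ := hb (k - 1) (k - 1) le_rfl (by omega)
      have := h4.one_le_m
      rw [sub_add_cancel] at h5
      exact ⟨k - 1, by omega, by omega, by rw [sub_add_cancel]; omega⟩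

/-- Going to the left the types decrease, so in the divergent case the blocks are `1 0^n` with `n >
L`, and the ones are isolated. -/
theorem tailSmall_left (hs : AvoidsPrime s) : TailSmall (fun k : ℕ => s (-k)) := by
  by_cases hinf : ∀ N : ℕ, ∃ k, N ≤ k ∧ IsAscent s (-k : ℤ)
  swap
  · push Not at hinf
    obtain ⟨N, hN⟩ := hinf
    by_cases h1 : ∃ j : ℕ, N ≤ j ∧ s (-j) = 1
    · obtain ⟨j, hj, hj0⟩ := h1
      refine TailSmall.of_eventually_const (N := j) (c := 1) ?_
      intro k hk
      induction k, hk using Nat.le_induction with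
      | base => exact hj0
      | succ k hk ih =>
        by_contra hc
        refine hN (k + 1) (by omega) ⟨by omega, ?_⟩
        rw [← ih]; congr 1; push_cast; ring
    · push Not at h1
      refine TailSmall.of_eventually_const (N := N) (c := 0) fun k hk => ?_
      have := h1 k (by omega)
      omega
  obtain ⟨e, m, n, he0, hb⟩ := exists_blocks_left hinf
  obtain ⟨K, hK0, hK⟩ := eventually_le_left hs hb
  have hchain : ∀ A, BlockChain A (-2) m n _ _ := fun A => (hb A).blockChain (B := -2) hs
  have heneg : ∀ k, k ≤ 0 → e k ≤ 0 := by
    intro k hk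
    induction k, hk using Int.leInductionDown with
    | base => exact he0
    | pred k hk ih =>
      have := (hb (k - 1) (k - 1) le_rfl (by omega)).2
      rw [sub_add_cancel] at this
      omega
  intro L
  rcases eventually_const_or_tendsto (f := fun k => -blockType m n (-k)) (K := -K) (by
      intro k hk
      have := hK (-k) (by omega)
      rw [show -(k + 1) = -k - 1 by ring]
      omega) with ⟨c, K', hK', hc⟩ | hc
  · left
    have hc' : ∀ k, k ≤ -K' → blockType m n k = -c := fun k hk => by
      have := hc (-k) (by omega)
      rw [neg_neg] at this
      omega
    have hmn : ∀ k, k ≤ -K' → m k = m (-K') ∧ n k = n (-K') := fun k hk =>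
      (hchain k).eq_of_blockType_eq le_rfl (by omega) hk (by omega)
        (by rw [hc' k hk, hc' _ le_rfl])
    have hpos := (hb (-K') (-K') le_rfl (by omega)).1.one_le_m
    have := heneg (-K') (by omega)
    refine ⟨m (-K') + n (-K'), (-e (-K')).toNat, by omega, fun i hi => ?_⟩
    obtain ⟨k, h1, h2, h3⟩ := exists_block_left hb (K := -K') (i := -i) (by omega) (by omega)
    obtain ⟨hb1, he1⟩ := hb k k le_rfl (by omega)
    obtain ⟨hb2, he2⟩ := hb (k - 1) (k - 1) le_rfl (by omega)
    obtain ⟨hm1, hn1⟩ := hmn k (by omega)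
    obtain ⟨hm2, hn2⟩ := hmn (k - 1) (by omega)
    rw [hm1, hn1] at hb1 he1
    rw [hm2, hn2] at hb2 he2
    rw [sub_add_cancel] at he2
    beta_reduce
    rw [← hb1.eq_of_isBlock hb2 h2 (by omega)]
    congr 1
    push_cast
    omega
  · right
    obtain ⟨K', hK', hq⟩ := hc L
    have hq' : ∀ k, k ≤ -K' → blockType m n k ≤ -L := fun k hk => by
      have := hq (-k) (by omega)
      rw [neg_neg] at this
      omega
    have := heneg (-K') (by omega)
    refine ⟨1, (-e (-K')).toNat, fun i hi hi0 j hj1 hj2 => ?_⟩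
    obtain ⟨k, h1, h2, h3⟩ := exists_block_left hb (K := -K') (i := -i) (by omega) (by omega)
    obtain ⟨hb1, he1⟩ := hb k k le_rfl (by omega)
    obtain ⟨hb2, he2⟩ := hb (k - 1) (k - 1) le_rfl (by omega)
    rw [sub_add_cancel] at he2
    obtain ⟨hm, hn⟩ := (hchain k).type_nonpos (k := k) le_rfl (by omega)
      (by have := hq' k (by omega); omega)
    obtain ⟨hm', hn'⟩ := (hchain (k - 1)).type_nonpos (k := k - 1) le_rfl (by omega)
      (by have := hq' (k - 1) (by omega); omega)
    have hend : -(i : ℤ) = e k + 1 := by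
      by_contra hne
      have := hb1.zeros (-i) (by omega) (by omega)
      simp only at hi0
      omega
    have := hq' (k - 1) (by omega)
    have hz : s (-(i + j)) = 0 := by
      rcases (show j = 1 ∨ 2 ≤ j by omega) with rfl | hj
      · rw [← hb1.start]; congr 1; push_cast; omega
      · exact hb2.zeros _ (by omega) (by omega)
    simp only [Nat.cast_add]
    omega

end Left

/-! ### Hausdorff dimension of sets of pairs with small tails -/

open scoped ENNReal NNReal in
/-- For each `k`, the first `L * k` digits of the elements of `S` are determined by `k` symbols
from an alphabet of `L + 1` letters. -/
def SparselyCoded (L : ℕ) (S : Set (ℕ → Fin 2)) : Prop :=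
  ∀ k : ℕ, ∃ code : (ℕ → Fin 2) → Fin k → Fin (L + 1),
    ∀ d ∈ S, ∀ d' ∈ S, code d = code d' → ∀ i < L * k, d i = d' i

/-- The pair of real numbers with the given binary digits. -/
noncomputable def pairValue (p : (ℕ → Fin 2) × (ℕ → Fin 2)) : ℝ × ℝ :=
  (Real.ofDigits p.1, Real.ofDigits p.2)

theorem edist_ofDigits_le {d d' : ℕ → Fin 2} {k : ℕ} (h : ∀ i < k, d i = d' i) :
    edist (Real.ofDigits d) (Real.ofDigits d') ≤ (2⁻¹ : ENNReal) ^ k := by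
  rw [edist_dist, Real.dist_eq]
  refine (ENNReal.ofReal_le_ofReal (Real.abs_ofDigits_sub_ofDigits_le h)).trans_eq ?_
  rw [ENNReal.ofReal_inv_of_pos (by positivity), ENNReal.ofReal_pow (by positivity),
    ← ENNReal.inv_pow]
  simp

open scoped ENNReal NNReal in
-- At stage `k` the codes give a cover by `(L + 1) ^ (2 * k)` sets of diameter at most `2 ^ (-L *
-- k)`; by `hd` the sums of their `d`-th powers stay bounded by one.
theorem dimH_image_pairValue_le {L : ℕ} (hL : 1 ≤ L) {S T : Set (ℕ → Fin 2)}
    (hS : SparselyCoded L S) (hT : SparselyCoded L T) {d : ℝ≥0}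
    (hd : ((L + 1 : ℕ) : ℝ≥0∞) ^ 2 * ((2⁻¹ : ℝ≥0∞) ^ L) ^ (d : ℝ) ≤ 1) :
    dimH (pairValue '' (S ×ˢ T)) ≤ d := by
  choose c hc using hS
  choose c' hc' using hT
  have hr : Filter.Tendsto (fun k : ℕ => ((2⁻¹ : ℝ≥0∞) ^ L) ^ k) Filter.atTop (nhds 0) := by
    refine ENNReal.tendsto_pow_atTop_nhds_zero_of_lt_one ?_
    exact pow_lt_one₀ zero_le (by simp) (by omega)
  set t : ∀ k : ℕ, ((Fin k → Fin (L + 1)) × (Fin k → Fin (L + 1))) → Set (ℝ × ℝ) :=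
    fun k a => pairValue '' {p | (p.1 ∈ S ∧ p.2 ∈ T) ∧ c k p.1 = a.1 ∧ c' k p.2 = a.2}
  have hdiam : ∀ k a, Metric.ediam (t k a) ≤ ((2⁻¹ : ℝ≥0∞) ^ L) ^ k := by
    intro k a
    refine Metric.ediam_le ?_
    rintro _ ⟨p, ⟨⟨p1, p2⟩, p3, p4⟩, rfl⟩ _ ⟨q, ⟨⟨q1, q2⟩, q3, q4⟩, rfl⟩
    rw [Prod.edist_eq, ← pow_mul]
    exact max_le (edist_ofDigits_le (hc k _ p1 _ q1 (p3.trans q3.symm)))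
      (edist_ofDigits_le (hc' k _ p2 _ q2 (p4.trans q4.symm)))
  have hcover : ∀ k, pairValue '' (S ×ˢ T) ⊆ ⋃ a, t k a := by
    rintro k _ ⟨p, ⟨p1, p2⟩, rfl⟩
    exact mem_iUnion.2 ⟨(c k p.1, c' k p.2), p, ⟨⟨p1, p2⟩, rfl, rfl⟩, rfl⟩
  have hle := Measure.hausdorffMeasure_le_liminf_sum (d : ℝ) (pairValue '' (S ×ˢ T)) _ hr t
    (Filter.Eventually.of_forall hdiam) (Filter.Eventually.of_forall hcover)
  refine dimH_le_of_hausdorffMeasure_ne_top (ne_top_of_le_ne_top ENNReal.one_ne_top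
    (hle.trans ?_))
  have hsum : ∀ k, ∑ a, Metric.ediam (t k a) ^ (d : ℝ) ≤ 1 := by
    intro k
    calc ∑ a, Metric.ediam (t k a) ^ (d : ℝ)
        ≤ ∑ _a : (Fin k → Fin (L + 1)) × (Fin k → Fin (L + 1)),
            (((2⁻¹ : ℝ≥0∞) ^ L) ^ k) ^ (d : ℝ) :=
          Finset.sum_le_sum fun a _ => ENNReal.rpow_le_rpow (hdiam k a) d.2
      _ = (((L + 1 : ℕ) : ℝ≥0∞) ^ 2 * ((2⁻¹ : ℝ≥0∞) ^ L) ^ (d : ℝ)) ^ k := by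
          rw [Finset.sum_const, Finset.card_univ, Fintype.card_prod, Fintype.card_fun,
            Fintype.card_fin, Fintype.card_fin, nsmul_eq_mul, mul_pow,
            ← ENNReal.rpow_natCast (((2⁻¹ : ℝ≥0∞) ^ L) ^ (d : ℝ)) k,
            ← ENNReal.rpow_natCast ((2⁻¹ : ℝ≥0∞) ^ L) k, ← ENNReal.rpow_mul, ← ENNReal.rpow_mul,
            mul_comm (d : ℝ)]
          congr 1
          push_cast
          rw [← mul_pow, ← sq]
      _ ≤ 1 := pow_le_one₀ zero_le hd
  exact (Filter.liminf_le_liminf (Filter.Eventually.of_forall hsum)).trans_eq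
    (Filter.liminf_const _)

/-- The sequences that start with the word `w` and continue with an isolated letter `c`
(`Sum.inl c`), or with period `p` (`Sum.inr p`). -/
def tailPiece (L : ℕ) : List (Fin 2) × (Fin 2 ⊕ ℕ) → Set (ℕ → Fin 2)
  | (w, Sum.inl c) => {d | (∀ i (h : i < w.length), d i = w[i]) ∧
      ∀ k, w.length ≤ k → d k = c → ∀ i, 1 ≤ i → i ≤ L → d (k + i) ≠ c}
  | (w, Sum.inr p) => {d | (∀ i (h : i < w.length), d i = w[i]) ∧ 1 ≤ p ∧ p ≤ w.length ∧
      ∀ k, w.length ≤ k + p → d (k + p) = d k}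

theorem sparselyCoded_tailPiece {L : ℕ} (hL : 1 ≤ L) (a : List (Fin 2) × (Fin 2 ⊕ ℕ)) :
    SparselyCoded L (tailPiece L a) := by
  obtain ⟨w, c | p⟩ := a
  · intro k
    have hex : ∀ (d : ℕ → Fin 2) (j : Fin k), ∃ a : Fin (L + 1),
        d ∈ tailPiece L (w, Sum.inl c) → ∀ i < L, w.length ≤ L * j + i →
          (d (L * j + i) = c ↔ (a : ℕ) = i) := by
      intro d j
      by_cases h : ∃ i < L, w.length ≤ L * j + i ∧ d (L * j + i) = c
      · obtain ⟨i, h1, h2, h3⟩ := h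
        refine ⟨⟨i, by omega⟩, fun hd i' h1' h2' => ⟨fun h3' => ?_, fun h3' => ?_⟩⟩
        · rcases lt_trichotomy i i' with hlt | heq | hlt
          · refine absurd ?_ (hd.2 _ h2 h3 (i' - i) (by omega) (by omega))
            rw [← h3']; congr 1; omega
          · exact heq
          · refine absurd ?_ (hd.2 _ h2' h3' (i - i') (by omega) (by omega))
            rw [← h3]; congr 1; omega
        · rw [← show i = i' from h3', h3]
      · push Not at h
        -- A window of length `L` holds at most one letter `c` past the initial word; the symbol
        -- records its place, and the value `L` means that there is none.
        refine ⟨Fin.last L, fun hd i' h1' h2' => ⟨fun h3' => absurd h3' (h i' h1' h2'),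
          fun h3' => ?_⟩⟩
        simp at h3'
        omega
    choose code hcode using hex
    refine ⟨code, fun d hd d' hd' heq i hi => ?_⟩
    by_cases hw : i < w.length
    · rw [hd.1 i hw, hd'.1 i hw]
    · have hj : i / L < k := Nat.div_lt_of_lt_mul hi
      have hi' : L * (i / L) + i % L = i := Nat.div_add_mod i L
      have h1 := hcode d ⟨i / L, hj⟩ hd (i % L) (Nat.mod_lt _ hL) (by simp only; omega)
      have h2 := hcode d' ⟨i / L, hj⟩ hd' (i % L) (Nat.mod_lt _ hL) (by simp only; omega)
      simp only [hi'] at h1 h2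
      rw [heq] at h1
      have := h1.trans h2.symm
      omega
  · intro k
    refine ⟨fun _ _ => 0, fun d hd d' hd' _ i _ => ?_⟩
    induction i using Nat.strong_induction_on with
    | _ i ih =>
      by_cases hw : i < w.length
      · rw [hd.1 i hw, hd'.1 i hw]
      · obtain ⟨-, hp, hpw, h1⟩ := hd
        have e1 := h1 (i - p) (by omega)
        have e2 := hd'.2.2.2 (i - p) (by omega)
        rw [Nat.sub_add_cancel (by omega)] at e1 e2
        rw [e1, e2]
        exact ih (i - p) (by omega) (by omega)

theorem TailSmall.exists_mem_tailPiece {d : ℕ → Fin 2} (h : TailSmall d) (L : ℕ) :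
    ∃ a, d ∈ tailPiece L a := by
  rcases h L with ⟨p, N, hp, hN⟩ | ⟨c, N, hN⟩
  · refine ⟨(List.ofFn (fun i : Fin (N + p) => d i), Sum.inr p), ?_, hp, by simp, ?_⟩
    · intro i hi; simp
    · intro k hk
      rw [List.length_ofFn] at hk
      exact hN k (by omega)
  · refine ⟨(List.ofFn (fun i : Fin N => d i), Sum.inl c), ?_, ?_⟩
    · intro i hi; simp
    · intro k hk
      rw [List.length_ofFn] at hk
      exact hN k hk

open scoped ENNReal NNReal in
theorem exists_length_of_pos {d : ℝ≥0} (hd : 0 < d) : ∃ L : ℕ, 1 ≤ L ∧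
    ((L + 1 : ℕ) : ℝ≥0∞) ^ 2 * ((2⁻¹ : ℝ≥0∞) ^ L) ^ (d : ℝ) ≤ 1 := by
  have hone : (1 : ℝ) < 2 ^ (d : ℝ) := Real.one_lt_rpow (by norm_num) (by exact_mod_cast hd)
  have hlim := tendsto_pow_const_div_const_pow_of_one_lt 2 hone
  -- The factor `1/4` absorbs the passage from `L ^ 2` to `(L + 1) ^ 2 ≤ 4 * L ^ 2`.
  have hev := hlim.eventually (gt_mem_nhds (show (0 : ℝ) < 1 / 4 by norm_num))
  obtain ⟨L, hL, hL1⟩ := (hev.and (Filter.eventually_ge_atTop 1)).exists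
  refine ⟨L, hL1, ?_⟩
  have h2 : ((2⁻¹ : ℝ≥0∞) ^ L) ^ (d : ℝ) = ENNReal.ofReal (((2 : ℝ) ^ (d : ℝ)) ^ L)⁻¹ := by
    rw [← ENNReal.inv_pow, ENNReal.inv_rpow, ENNReal.ofReal_inv_of_pos (by positivity),
      ← ENNReal.rpow_natCast, ← ENNReal.rpow_mul, mul_comm, ENNReal.rpow_mul,
      ENNReal.rpow_natCast, ENNReal.ofReal_pow (by positivity),
      ← ENNReal.ofReal_rpow_of_pos (by norm_num)]
    simp
  rw [h2, ← ENNReal.ofReal_natCast, ← ENNReal.ofReal_pow (by positivity),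
    ← ENNReal.ofReal_mul (by positivity)]
  refine ENNReal.ofReal_le_one.2 ?_
  rw [← div_eq_mul_inv, div_le_one (by positivity)]
  rw [div_lt_iff₀ (by positivity)] at hL
  have : (1 : ℝ) ≤ L := by exact_mod_cast hL1
  push_cast
  nlinarith

/-- For each `d > 0` one fixed `L` suffices, and the initial words, letters and periods make only
countably many pieces. -/
theorem dimH_pairValue_tailSmall :
    dimH (pairValue '' {p | TailSmall p.1 ∧ TailSmall p.2}) = 0 := by
  by_contra hne
  obtain ⟨d, hd0, hd⟩ := ENNReal.lt_iff_exists_nnreal_btwn.1 (pos_iff_ne_zero.2 hne)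
  obtain ⟨L, hL, hLd⟩ := exists_length_of_pos (ENNReal.coe_pos.1 hd0)
  refine absurd hd (not_lt.2 ?_)
  have hsub : pairValue '' {p | TailSmall p.1 ∧ TailSmall p.2} ⊆
      ⋃ a : (List (Fin 2) × (Fin 2 ⊕ ℕ)) × (List (Fin 2) × (Fin 2 ⊕ ℕ)),
        pairValue '' (tailPiece L a.1 ×ˢ tailPiece L a.2) := by
    rintro _ ⟨p, ⟨h1, h2⟩, rfl⟩
    obtain ⟨a, ha⟩ := h1.exists_mem_tailPiece L
    obtain ⟨b, hb⟩ := h2.exists_mem_tailPiece L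
    exact mem_iUnion.2 ⟨(a, b), p, ⟨ha, hb⟩, rfl⟩
  refine (dimH_mono hsub).trans ?_
  rw [dimH_iUnion]
  exact iSup_le fun a => dimH_image_pairValue_le hL (sparselyCoded_tailPiece hL _)
    (sparselyCoded_tailPiece hL _) hLd

/-! ### The quadrilaterals -/

theorem Convex.mem_of_mem_of_mem_of_le {K : Set (ℝ × ℝ)} (hK : Convex ℝ K) {x y y₁ y₂ : ℝ}
    (h1 : (x, y₁) ∈ K) (h2 : (x, y₂) ∈ K) (hy1 : y₁ ≤ y) (hy2 : y ≤ y₂) : (x, y) ∈ K := by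
  rcases hy1.eq_or_lt with rfl | hlt
  · exact h1
  have hpos : 0 < y₂ - y₁ := by linarith
  have := hK h1 h2 (a := (y₂ - y) / (y₂ - y₁)) (b := (y - y₁) / (y₂ - y₁))
    (div_nonneg (by linarith) hpos.le) (div_nonneg (by linarith) hpos.le) (by field_simp; ring)
  convert this using 1
  ext <;> simp <;> field_simp <;> ring

theorem Convex.mem_of_line {K : Set (ℝ × ℝ)} (hK : Convex ℝ K) {x x₁ x₂ c k : ℝ}
    (h1 : (x₁, c + k * x₁) ∈ K) (h2 : (x₂, c + k * x₂) ∈ K) (hx1 : x₁ ≤ x) (hx2 : x ≤ x₂) :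
    (x, c + k * x) ∈ K := by
  rcases hx1.eq_or_lt with rfl | hlt
  · exact h1
  have hpos : 0 < x₂ - x₁ := by linarith
  have := hK h1 h2 (a := (x₂ - x) / (x₂ - x₁)) (b := (x - x₁) / (x₂ - x₁))
    (div_nonneg (by linarith) hpos.le) (div_nonneg (by linarith) hpos.le) (by field_simp; ring)
  convert this using 1
  ext <;> simp <;> field_simp <;> ring

/-- The region cut out by the lines through the sides of a quadrilateral with vertices
`(0, 1/2)`, `(a, b)`, `(1/2, 1)`, `(0, 1)`; here `p` and `q` are the slopes of the lower sides. -/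
def quadRegion (p q : ℝ) : Set (ℝ × ℝ) :=
  {P | 0 < P.1 ∧ P.2 < 1 ∧ 1 / 2 + p * P.1 < P.2 ∧ 1 - q * (1 / 2 - P.1) < P.2}

theorem isOpen_quadRegion (p q : ℝ) : IsOpen (quadRegion p q) := by
  have h1 : IsOpen {P : ℝ × ℝ | 0 < P.1} := isOpen_lt (by fun_prop) (by fun_prop)
  have h2 : IsOpen {P : ℝ × ℝ | P.2 < 1} := isOpen_lt (by fun_prop) (by fun_prop)
  have h3 : IsOpen {P : ℝ × ℝ | 1 / 2 + p * P.1 < P.2} := isOpen_lt (by fun_prop) (by fun_prop)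
  have h4 : IsOpen {P : ℝ × ℝ | 1 - q * (1 / 2 - P.1) < P.2} :=
    isOpen_lt (by fun_prop) (by fun_prop)
  exact h1.inter (h2.inter (h3.inter h4))

theorem interior_convexHull_quad {a b p q : ℝ} (ha : 0 < a) (ha' : a < 1 / 2)
    (hp : b = 1 / 2 + p * a) (hq : b = 1 - q * (1 / 2 - a)) (hpq : p ≤ q) :
    interior (convexHull ℝ {((0 : ℝ), (1 / 2 : ℝ)), (a, b), (1 / 2, 1), (0, 1)}) =
      quadRegion p q := by
  have hq1 : 1 ≤ q := by
    by_contra! hc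
    have : p * a < 1 * a := mul_lt_mul_of_pos_right (by linarith) ha
    have : q * (1 / 2 - a) < 1 * (1 / 2 - a) := mul_lt_mul_of_pos_right hc (by linarith)
    linarith
  have hp1 : p ≤ 1 := by
    by_contra! hc
    have : 1 * a < p * a := mul_lt_mul_of_pos_right hc ha
    have : 1 * (1 / 2 - a) < q * (1 / 2 - a) := mul_lt_mul_of_pos_right (by linarith) (by linarith)
    linarith
  have hqa := mul_nonneg (by linarith : 0 ≤ q) (by linarith : 0 ≤ 1 / 2 - a)
  apply Subset.antisymm
  · have hsub : convexHull ℝ {((0 : ℝ), (1 / 2 : ℝ)), (a, b), (1 / 2, 1), (0, 1)} ⊆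
        {P | 0 ≤ P.1 ∧ P.2 ≤ 1 ∧ 1 / 2 + p * P.1 ≤ P.2 ∧ 1 - q * (1 / 2 - P.1) ≤ P.2} := by
      refine convexHull_min ?_ ?_
      · rintro P (rfl | rfl | rfl | rfl) <;> refine ⟨?_, ?_, ?_, ?_⟩ <;> dsimp only <;> linarith
      · rintro P ⟨h1, h2, h3, h4⟩ Q ⟨k1, k2, k3, k4⟩ s t hs ht hst
        obtain rfl : t = 1 - s := by linarith
        refine ⟨?_, ?_, ?_, ?_⟩ <;> simp only [Prod.fst_add, Prod.snd_add, Prod.smul_fst,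
          Prod.smul_snd, smul_eq_mul]
        · linarith [mul_nonneg hs h1, mul_nonneg ht k1]
        · linarith [mul_le_mul_of_nonneg_left h2 hs, mul_le_mul_of_nonneg_left k2 ht]
        · linarith [mul_le_mul_of_nonneg_left h3 hs, mul_le_mul_of_nonneg_left k3 ht]
        · linarith [mul_le_mul_of_nonneg_left h4 hs, mul_le_mul_of_nonneg_left k4 ht]
    intro P hP
    obtain ⟨ε, hε, hball⟩ := Metric.mem_nhds_iff.1 (mem_interior_iff_mem_nhds.1 hP)
    have hmem : ∀ s t : ℝ, |s| < ε → |t| < ε → (P.1 + s, P.2 + t) ∈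
        {P : ℝ × ℝ | 0 ≤ P.1 ∧ P.2 ≤ 1 ∧ 1 / 2 + p * P.1 ≤ P.2 ∧
          1 - q * (1 / 2 - P.1) ≤ P.2} := by
      intro s t hs ht
      refine hsub (hball ?_)
      rw [Metric.mem_ball, Prod.dist_eq, Real.dist_eq, Real.dist_eq]
      simpa using ⟨hs, ht⟩
    -- Small moves along the axes turn the weak inequalities of the closed half-planes into strict
    -- ones.
    have hε2 : |ε / 2| < ε := by rw [abs_of_pos (by linarith)]; linarith
    have hε2' : |(-(ε / 2))| < ε := by rwa [abs_neg]
    have e1 := hmem (-(ε / 2)) 0 hε2' (by simpa)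
    have e2 := hmem 0 (ε / 2) (by simpa) hε2
    have e3 := hmem 0 (-(ε / 2)) (by simpa) hε2'
    simp only [mem_ofPred_eq, add_zero] at e1 e2 e3
    exact ⟨by linarith [e1.1], by linarith [e2.2.1], by linarith [e3.2.2.1],
      by linarith [e3.2.2.2]⟩
  · refine interior_maximal ?_ (isOpen_quadRegion p q)
    rintro ⟨x, y⟩ ⟨h1, h2, h3, h4⟩
    dsimp only at h1 h2 h3 h4
    have hK := convex_convexHull ℝ {((0 : ℝ), (1 / 2 : ℝ)), (a, b), (1 / 2, 1), (0, 1)}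
    have hV : ∀ v ∈ ({((0 : ℝ), (1 / 2 : ℝ)), (a, b), (1 / 2, 1), (0, 1)} : Set (ℝ × ℝ)),
      v ∈ convexHull ℝ {((0 : ℝ), (1 / 2 : ℝ)), (a, b), (1 / 2, 1), (0, 1)} :=
      fun v hv => subset_convexHull ℝ _ hv
    have hx : x < 1 / 2 := by
      by_contra! hc
      have := mul_nonneg (by linarith : 0 ≤ q) (by linarith : 0 ≤ x - 1 / 2)
      linarith
    have htop : (x, (1 : ℝ)) ∈ convexHull ℝ {((0 : ℝ), (1 / 2 : ℝ)), (a, b), (1 / 2, 1), (0, 1)} := by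
      have := hK.mem_of_line (x := x) (x₁ := 0) (x₂ := 1 / 2) (c := 1) (k := 0)
        (by simpa using hV (0, 1) (by simp)) (by simpa using hV (1 / 2, 1) (by simp)) h1.le hx.le
      simpa using this
    -- The point lies on the vertical segment from a lower side to the top side; which lower side
    -- depends on the position of `x` relative to `a`.
    rcases le_total x a with hxa | hxa
    · have := hK.mem_of_line (x := x) (x₁ := 0) (x₂ := a) (c := 1 / 2) (k := p)
        (by simpa using hV (0, 1 / 2) (by simp)) (by rw [← hp]; exact hV (a, b) (by simp)) h1.le hxa
      exact hK.mem_of_mem_of_mem_of_le this htop h3.le h2.le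
    · have := hK.mem_of_line (x := x) (x₁ := a) (x₂ := 1 / 2) (c := 1 - q / 2) (k := q)
        (by convert hV (a, b) (by simp) using 2; rw [hq]; ring)
        (by convert hV (1 / 2, 1) (by simp) using 2; ring) hxa hx.le
      exact hK.mem_of_mem_of_mem_of_le this htop (by linarith) h2.le

theorem deltaPrime_eq : deltaPrime = quadRegion (4 / 5) (8 / 7) :=
  interior_convexHull_quad (by norm_num) (by norm_num) (by norm_num) (by norm_num) (by norm_num)

theorem deltaDoublePrime_eq : deltaDoublePrime = quadRegion (7 / 8) (5 / 4) :=
  interior_convexHull_quad (by norm_num) (by norm_num) (by norm_num) (by norm_num) (by norm_num)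

theorem bigDelta_eq_interior : bigDelta = interior (convexHull ℝ
    {((0 : ℝ), (1 / 2 : ℝ)), (1 / 3, 2 / 3), (1 / 2, 1), (0, 1)}) := by
  rw [bigDelta]
  congr 2
  ext P
  simp only [mem_insert_iff, mem_singleton_iff]
  tauto

theorem bigDelta_eq : bigDelta = quadRegion (1 / 2) 2 := by
  rw [bigDelta_eq_interior]
  exact interior_convexHull_quad (by norm_num) (by norm_num) (by norm_num) (by norm_num)
    (by norm_num)

theorem deltaPrime_subset_bigDelta : deltaPrime ⊆ bigDelta := by
  rw [deltaPrime_eq, bigDelta_eq]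
  rintro ⟨x, y⟩ ⟨h1, h2, h3, h4⟩
  dsimp only at h1 h2 h3 h4
  refine ⟨h1, h2, ?_, ?_⟩ <;> dsimp only <;> linarith

theorem deltaDoublePrime_subset_bigDelta : deltaDoublePrime ⊆ bigDelta := by
  rw [deltaDoublePrime_eq, bigDelta_eq]
  rintro ⟨x, y⟩ ⟨h1, h2, h3, h4⟩
  dsimp only at h1 h2 h3 h4
  refine ⟨h1, h2, ?_, ?_⟩ <;> dsimp only <;> linarith

theorem not_deltaDoublePrime_subset_deltaPrime : ¬ deltaDoublePrime ⊆ deltaPrime := by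
  rw [deltaPrime_eq, deltaDoublePrime_eq]
  intro h
  have := (h (a := ((1 / 3 : ℝ), (4 / 5 : ℝ))) (by norm_num [quadRegion])).2.2.2
  norm_num at this

theorem not_deltaPrime_subset_deltaDoublePrime : ¬ deltaPrime ⊆ deltaDoublePrime := by
  rw [deltaPrime_eq, deltaDoublePrime_eq]
  intro h
  have := (h (a := ((1 / 5 : ℝ), (2 / 3 : ℝ))) (by norm_num [quadRegion])).2.2.1
  norm_num at this

theorem volume_quadRegion {a p q : ℝ} (ha : 0 < a) (ha' : a < 1 / 2)
    (hpq : 1 / 2 + p * a = 1 - q * (1 / 2 - a)) (h0 : 0 ≤ p) (hle : p ≤ q) :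
    volume (quadRegion p q) =
      ENNReal.ofReal (a / 2 - p * a ^ 2 / 2 + q * (1 / 2 - a) ^ 2 / 2) := by
  set f : ℝ → ℝ := fun x => max (1 / 2 + p * x) (1 - q * (1 / 2 - x))
  have hf : Continuous f := by fun_prop
  have hq : 0 ≤ q := h0.trans hle
  have hf1 : ∀ x, x ≤ a → f x = 1 / 2 + p * x := fun x hx => max_eq_left (by
    linarith [mul_nonneg (sub_nonneg.2 hle) (sub_nonneg.2 hx)])
  have hf2 : ∀ x, a ≤ x → f x = 1 - q * (1 / 2 - x) := fun x hx => max_eq_right (by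
    linarith [mul_nonneg (sub_nonneg.2 hle) (sub_nonneg.2 hx)])
  have hqa := mul_nonneg hq (by linarith : 0 ≤ 1 / 2 - a)
  have hreg : quadRegion p q = regionBetween f (fun _ => 1) (Ioc 0 (1 / 2)) := by
    ext ⟨x, y⟩
    simp only [quadRegion, regionBetween, mem_ofPred_eq, mem_Ioc, mem_Ioo, f, max_lt_iff]
    constructor
    · rintro ⟨h1, h2, h3, h4⟩
      refine ⟨⟨h1, ?_⟩, ⟨h3, h4⟩, h2⟩
      by_contra! hc
      linarith [mul_nonneg hq (by linarith : 0 ≤ x - 1 / 2)]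
    · rintro ⟨⟨h1, -⟩, ⟨h3, h4⟩, h2⟩
      exact ⟨h1, h2, h3, h4⟩
  have hint := volume_regionBetween_eq_integral (μ := volume) (f := f) (g := fun _ => (1 : ℝ))
    (s := Ioc 0 (1 / 2)) (hf.integrableOn_Ioc) (continuous_const.integrableOn_Ioc)
    measurableSet_Ioc (by
      intro x hx
      rcases le_total x a with hxa | hxa
      · rw [hf1 x hxa]
        linarith [mul_le_mul_of_nonneg_left hxa h0]
      · rw [hf2 x hxa]
        linarith [mul_nonneg hq (sub_nonneg.2 hx.2)])
  rw [hreg, Measure.volume_eq_prod, hint]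
  congr 1
  rw [← intervalIntegral.integral_of_le (by norm_num)]
  have hii : ∀ x y, IntervalIntegrable ((fun _ : ℝ => (1 : ℝ)) - f) volume x y := fun x y =>
    (continuous_const.sub hf).intervalIntegrable x y
  rw [← intervalIntegral.integral_add_adjacent_intervals (hii 0 a) (hii a (1 / 2))]
  have e1 : ∫ x in (0 : ℝ)..a, ((fun _ : ℝ => (1 : ℝ)) - f) x = ∫ x in (0 : ℝ)..a, (1 / 2 - p * x) :=
    intervalIntegral.integral_congr fun x hx => by
      rw [uIcc_of_le ha.le] at hx
      simp only [Pi.sub_apply, hf1 x hx.2]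
      ring
  have e2 : ∫ x in a..(1 / 2 : ℝ), ((fun _ : ℝ => (1 : ℝ)) - f) x =
      ∫ x in a..(1 / 2 : ℝ), (q / 2 - q * x) :=
    intervalIntegral.integral_congr fun x hx => by
      rw [uIcc_of_le ha'.le] at hx
      simp only [Pi.sub_apply, hf2 x hx.1]
      ring
  have hlin : ∀ α β c d : ℝ, ∫ x in c..d, (α - β * x) = α * (d - c) - β * ((d ^ 2 - c ^ 2) / 2) := by
    intro α β c d
    rw [intervalIntegral.integral_sub (continuous_const.intervalIntegrable _ _)
      ((by fun_prop : Continuous fun x : ℝ => β * x).intervalIntegrable _ _),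
      intervalIntegral.integral_const, intervalIntegral.integral_const_mul, integral_id]
    simp [mul_comm]
  rw [e1, e2, hlin, hlin]
  ring

theorem volume_deltaPrime : volume deltaPrime = ENNReal.ofReal (13 / 96) := by
  rw [deltaPrime_eq, volume_quadRegion (a := 5 / 24) (by norm_num) (by norm_num) (by norm_num)
    (by norm_num) (by norm_num)]
  norm_num

theorem volume_deltaDoublePrime : volume deltaDoublePrime = ENNReal.ofReal (13 / 96) := by
  rw [deltaDoublePrime_eq, volume_quadRegion (a := 1 / 3) (by norm_num) (by norm_num)
    (by norm_num) (by norm_num) (by norm_num)]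
  norm_num

/-! ### The survivor sets of the two quadrilaterals -/

theorem codedSurvivorSet_subset_of_tailSmall {H : Set (ℝ × ℝ)}
    (h : ∀ s : ℤ → Fin 2, (∀ i, (rightValue s i, leftValue s i) ∉ H) →
      TailSmall (fun k : ℕ => s (k + 1)) ∧ TailSmall (fun k : ℕ => s (-k))) :
    codedSurvivorSet H ⊆ pairValue '' {p | TailSmall p.1 ∧ TailSmall p.2} := by
  rintro _ ⟨s, hs, rfl⟩
  refine ⟨(fun k : ℕ => s (k + 1), fun k : ℕ => s (-k)), h s fun i => ?_, (codingMap_eq s).symm⟩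
  rw [← codingMap_shift]
  exact hs i

theorem dimH_codedSurvivorSet_deltaPrime : dimH (codedSurvivorSet deltaPrime) = 0 := by
  refine le_antisymm ((dimH_mono (codedSurvivorSet_subset_of_tailSmall fun s hs => ?_)).trans_eq
    dimH_pairValue_tailSmall) zero_le
  have hav : AvoidsPrime s := by
    rintro i ⟨h1, h2, h3, h4⟩
    apply hs i
    rw [deltaPrime_eq]
    exact ⟨h1, h2, h3, by dsimp only; linarith⟩
  exact ⟨tailSmall_right hav, tailSmall_left hav⟩

/-! ### Symmetry between the two quadrilaterals -/

theorem ofDigits_complement (d : ℕ → Fin 2) :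
    Real.ofDigits (fun k => 1 - d k) = 1 - Real.ofDigits d := by
  have h1 : Real.ofDigits (fun _ => (1 : Fin 2)) = 1 := Real.ofDigits_const_last_eq_one 1
  have hsum : Real.ofDigits d + Real.ofDigits (fun k => 1 - d k) =
      Real.ofDigits (fun _ => (1 : Fin 2)) := by
    simp only [Real.ofDigits]
    rw [← Real.summable_ofDigitsTerm.tsum_add Real.summable_ofDigitsTerm]
    refine tsum_congr fun k => ?_
    simp only [Real.ofDigitsTerm]
    rcases (show d k = 0 ∨ d k = 1 by omega) with h | h <;> rw [h] <;> simp
  linarith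

/-- The sequence read backwards with its letters exchanged. -/
def reverseComplement (s : ℤ → Fin 2) (i : ℤ) : Fin 2 := 1 - s (1 - i)

theorem rightValue_reverseComplement (s : ℤ → Fin 2) (i : ℤ) :
    rightValue (reverseComplement s) i = 1 - leftValue s (-i) := by
  rw [leftValue, ← ofDigits_complement, rightValue]
  congr 1; funext k
  simp only [reverseComplement]
  congr 2; ring

theorem leftValue_reverseComplement (s : ℤ → Fin 2) (i : ℤ) :
    leftValue (reverseComplement s) i = 1 - rightValue s (-i) := by
  rw [rightValue, ← ofDigits_complement, leftValue]
  congr 1; funext k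
  simp only [reverseComplement]
  congr 2; ring

theorem dimH_codedSurvivorSet_deltaDoublePrime : dimH (codedSurvivorSet deltaDoublePrime) = 0 := by
  refine le_antisymm ((dimH_mono (codedSurvivorSet_subset_of_tailSmall fun s hs => ?_)).trans_eq
    dimH_pairValue_tailSmall) zero_le
  have hav : AvoidsPrime (reverseComplement s) := by
    rintro i ⟨h1, h2, h3, h4⟩
    rw [rightValue_reverseComplement, leftValue_reverseComplement] at *
    apply hs (-i)
    rw [deltaDoublePrime_eq]
    refine ⟨?_, ?_, ?_, ?_⟩ <;> dsimp only <;> linarith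
  have hcc : ∀ a : Fin 2, 1 - (1 - a) = a := by decide
  constructor
  · convert (tailSmall_left hav).complement using 1
    funext k
    simp only [reverseComplement, hcc]
    congr 1; ring
  · convert (tailSmall_right hav).complement using 1
    funext k
    simp only [reverseComplement, hcc]
    congr 1; ring

/-! ### The baker's map and the shift -/

/-- Iteration gives `|D i| ≤ (1/2) ^ n` for all `n`. This identifies the coordinates of an orbit
with the binary values of its itinerary. -/
theorem eq_zero_of_eq_half_succ {D : ℤ → ℝ} (hD : ∀ i, |D i| ≤ 1)
    (h : ∀ i, D i = D (i + 1) / 2) (i : ℤ) : D i = 0 := by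
  have key : ∀ n : ℕ, D i = D (i + n) * (1 / 2) ^ n := by
    intro n
    induction n with
    | zero => simp
    | succ n ih => rw [ih, h (i + n), pow_succ]; push_cast; rw [add_assoc]; ring
  have hle : ∀ n : ℕ, |D i| ≤ (1 / 2) ^ n := by
    intro n
    rw [key n, abs_mul, abs_of_pos (show (0 : ℝ) < (1 / 2) ^ n by positivity)]
    exact mul_le_of_le_one_left (by positivity) (hD _)
  have := ge_of_tendsto' (tendsto_pow_atTop_nhds_zero_of_lt_one (by norm_num)
    (by norm_num : (1 / 2 : ℝ) < 1)) hle
  exact abs_nonpos_iff.1 this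

theorem survivorSet_subset_codedSurvivorSet (H : Set (ℝ × ℝ)) :
    survivorSet H ⊆ codedSurvivorSet H := by
  rintro p ⟨hp, hH⟩
  set P : ℤ → unitSquare := fun n => (baker ^ n) ⟨p, hp⟩
  have hP : ∀ n, ((P (n + 1) : unitSquare) : ℝ × ℝ) = bakerFun (P n) := by
    intro n
    simp only [P]
    rw [add_comm, zpow_one_add]
    rfl
  classical
  set s : ℤ → Fin 2 := fun n => if ((P (n - 1) : unitSquare) : ℝ × ℝ).1 < 1 / 2 then 0 else 1
  have hstep : ∀ n, ((P n : unitSquare) : ℝ × ℝ).1 =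
        ((s (n + 1) : ℕ) + ((P (n + 1) : unitSquare) : ℝ × ℝ).1) / 2 ∧
      ((P (n + 1) : unitSquare) : ℝ × ℝ).2 =
        ((s (n + 1) : ℕ) + ((P n : unitSquare) : ℝ × ℝ).2) / 2 := by
    intro n
    rw [hP n]
    simp only [s, add_sub_cancel_right, bakerFun]
    split_ifs <;> (constructor <;> simp <;> ring)
  have hmem := fun n => (P n).2
  have hx : ∀ n, rightValue s n = ((P n : unitSquare) : ℝ × ℝ).1 := by
    intro n
    refine sub_eq_zero.1 (eq_zero_of_eq_half_succ
      (D := fun n => rightValue s n - ((P n : unitSquare) : ℝ × ℝ).1) (fun i => ?_) (fun i => ?_) n)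
    · obtain ⟨⟨h1, h2⟩, -⟩ := hmem i
      rw [abs_le]
      constructor <;> linarith [rightValue_nonneg s i, rightValue_le_one s i]
    · rw [(hstep i).1, rightValue_step s i]; ring
  have hy : ∀ n, leftValue s n = ((P n : unitSquare) : ℝ × ℝ).2 := by
    intro n
    have := eq_zero_of_eq_half_succ
      (D := fun n => leftValue s (-n) - ((P (-n) : unitSquare) : ℝ × ℝ).2) (fun i => ?_)
      (fun i => ?_) (-n)
    · simp only [neg_neg] at this
      exact sub_eq_zero.1 this
    · obtain ⟨-, h1, h2⟩ := hmem (-i)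
      rw [abs_le]
      constructor <;> linarith [leftValue_nonneg s (-i), leftValue_le_one s (-i)]
    · have h1 := (hstep (-(i + 1))).2
      have h2 := leftValue_step s (-i)
      rw [show -(i + 1) + 1 = -i by ring] at h1
      rw [show -i - 1 = -(i + 1) by ring] at h2
      rw [h1, h2]; ring
  refine ⟨s, fun n => ?_, ?_⟩
  · rw [codingMap_shift, hx, hy]
    exact hH n
  · have := codingMap_shift s 0
    simp only [add_zero] at this
    rw [this, hx, hy]
    rfl

theorem dimH_survivorSet_eq_zero {H : Set (ℝ × ℝ)} (h : dimH (codedSurvivorSet H) = 0) :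
    dimH (survivorSet H) = 0 :=
  le_antisymm ((dimH_mono (survivorSet_subset_codedSurvivorSet H)).trans_eq h) zero_le

theorem isDimensionTrap_deltaPrime : IsDimensionTrap deltaPrime :=
  ⟨isOpen_interior, dimH_survivorSet_eq_zero dimH_codedSurvivorSet_deltaPrime⟩

theorem isDimensionTrap_deltaDoublePrime : IsDimensionTrap deltaDoublePrime :=
  ⟨isOpen_interior, dimH_survivorSet_eq_zero dimH_codedSurvivorSet_deltaDoublePrime⟩

theorem dimH_image_fst_eq_zero {S : Set (ℝ × ℝ)} (h : dimH S = 0) : dimH (Prod.fst '' S) = 0 :=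
  le_antisymm ((LipschitzWith.prod_fst.dimH_image_le S).trans_eq h) zero_le

theorem dimH_image_snd_eq_zero {S : Set (ℝ × ℝ)} (h : dimH S = 0) : dimH (Prod.snd '' S) = 0 :=
  le_antisymm ((LipschitzWith.prod_snd.dimH_image_le S).trans_eq h) zero_le

/-- A sequence with infinitely many zeros in both directions, no shift of which is mapped into `H`,
codes a point of the survivor set. -/
theorem mem_survivorSet_of_forall_notMem {H : Set (ℝ × ℝ)} {s : ℤ → Fin 2}
    (hx : ∀ i, rightValue s i < 1) (hy : ∀ i, leftValue s i < 1)
    (hs : ∀ i, (rightValue s i, leftValue s i) ∉ H) (i : ℤ) :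
    (rightValue s i, leftValue s i) ∈ survivorSet H := by
  have hmem : ∀ i, (rightValue s i, leftValue s i) ∈ unitSquare := fun i =>
    ⟨⟨rightValue_nonneg s i, hx i⟩, leftValue_nonneg s i, hy i⟩
  set Q : ℤ → unitSquare := fun i => ⟨_, hmem i⟩
  have hQ : ∀ i, baker (Q i) = Q (i + 1) := by
    intro i
    refine Subtype.ext ?_
    have e1 := rightValue_step s i
    have e2 := leftValue_step s (i + 1)
    rw [add_sub_cancel_right] at e2
    change bakerFun (rightValue s i, leftValue s i) = (rightValue s (i + 1), leftValue s (i + 1))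
    rcases (show s (i + 1) = 0 ∨ s (i + 1) = 1 by omega) with h | h
    · rw [h] at e1 e2
      simp only [Fin.val_zero, Nat.cast_zero, zero_add] at e1 e2
      have : rightValue s i < 1 / 2 := by linarith [hx (i + 1)]
      simp only [bakerFun, if_pos this, e2]
      rw [e1]
      exact Prod.ext (by dsimp only; ring) rfl
    · rw [h] at e1 e2
      simp only [Fin.val_one, Nat.cast_one] at e1 e2
      have : ¬ rightValue s i < 1 / 2 := by linarith [rightValue_nonneg s (i + 1)]
      simp only [bakerFun, if_neg this, e2]
      rw [e1]
      exact Prod.ext (by dsimp only; ring) (by dsimp only; ring)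
  refine ⟨hmem i, fun n => ?_⟩
  have hpow : (baker ^ n) (Q i) = Q (i + n) := by
    induction n using Int.induction_on with
    | zero => simp
    | succ n ih => rw [add_comm, zpow_one_add, Equiv.Perm.mul_apply, ih, hQ]; congr 1; ring
    | pred n ih =>
      have h1 : baker ((baker ^ (-(n : ℤ) - 1)) (Q i)) = baker (Q (i + (-(n : ℤ) - 1))) := by
        rw [← Equiv.Perm.mul_apply, ← zpow_one_add, hQ, add_sub_cancel, ih]; congr 1; ring
      exact baker.injective h1
  change (((baker ^ n) (Q i) : unitSquare) : ℝ × ℝ) ∉ H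
  rw [hpow]
  exact hs _

/-! ### Free concatenations of two words have positive dimension -/

/-- The concatenation of the words `U` and `V` of length `L`, chosen by `ω`. -/
def splice (L : ℤ) (U V ω : ℤ → Fin 2) (i : ℤ) : Fin 2 :=
  if ω (i / L) = 1 then V (i % L) else U (i % L)

theorem splice_mul_add {L : ℤ} (U V ω : ℤ → Fin 2) (k : ℤ) {r : ℤ} (h0 : 0 ≤ r) (h1 : r < L) :
    splice L U V ω (L * k + r) = if ω k = 1 then V r else U r := by
  have hq : (L * k + r) / L = k := by
    rw [Int.add_comm, Int.add_mul_ediv_left _ _ (by omega), Int.ediv_eq_zero_of_lt h0 h1, zero_add]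
  have hr : (L * k + r) % L = r := by
    rw [Int.add_comm, Int.add_mul_emod_self_left, Int.emod_eq_of_lt h0 h1]
  rw [splice, hq, hr]

theorem half_pow_le_ofDigits {d : ℕ → Fin 2} {t : ℕ} (h : d t = 1) :
    (1 / 2 : ℝ) ^ (t + 1) ≤ Real.ofDigits d := by
  have := Real.summable_ofDigitsTerm (digits := d).le_tsum t
    fun _ _ => Real.ofDigitsTerm_nonneg
  simpa [Real.ofDigitsTerm, h, Real.ofDigits] using this

theorem ofDigits_le_one_sub_half_pow {d : ℕ → Fin 2} {t : ℕ} (h : d t = 0) :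
    Real.ofDigits d ≤ 1 - (1 / 2) ^ (t + 1) := by
  have := half_pow_le_ofDigits (d := fun k => 1 - d k) (t := t) (by simp [h])
  rw [ofDigits_complement] at this
  linarith

theorem rightValue_lt_one {s : ℤ → Fin 2} {i j : ℤ} (hij : i < j) (h : s j = 0) :
    rightValue s i < 1 := by
  have := ofDigits_le_one_sub_half_pow (d := fun n : ℕ => s (i + 1 + n)) (t := (j - i - 1).toNat)
    (by rw [Int.toNat_of_nonneg (by omega), ← h]; congr 1; ring)
  have hp : (0 : ℝ) < (1 / 2) ^ ((j - i - 1).toNat + 1) := by positivity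
  rw [rightValue]
  linarith

theorem leftValue_lt_one {s : ℤ → Fin 2} {i j : ℤ} (hij : j ≤ i) (h : s j = 0) :
    leftValue s i < 1 := by
  have := ofDigits_le_one_sub_half_pow (d := fun n : ℕ => s (i - n)) (t := (i - j).toNat)
    (by rw [Int.toNat_of_nonneg (by omega), ← h]; congr 1; ring)
  have hp : (0 : ℝ) < (1 / 2) ^ ((i - j).toNat + 1) := by positivity
  rw [leftValue]
  linarith

/-- A lower bound for the distance of two numbers whose digits first differ at `a` and agree at
a later place `t`. -/
theorem le_dist_ofDigits {d d' : ℕ → Fin 2} {a t : ℕ} (hat : a < t) (heq : ∀ i < a, d i = d' i)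
    (hne : d a ≠ d' a) (ht : d t = d' t) :
    (1 / 2 : ℝ) ^ (t + 1) ≤ dist (Real.ofDigits d) (Real.ofDigits d') := by
  wlog hd : d a = 0 generalizing d d'
  · rw [dist_comm]
    exact this (fun i hi => (heq i hi).symm) hne.symm ht.symm (by omega)
  have hd' : d' a = 1 := by omega
  have e := Real.ofDigits_eq_sum_add_ofDigits d a
  have e' := Real.ofDigits_eq_sum_add_ofDigits d' a
  have hsum : ∑ i ∈ Finset.range a, Real.ofDigitsTerm d i =
      ∑ i ∈ Finset.range a, Real.ofDigitsTerm d' i :=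
    Finset.sum_congr rfl fun i hi => by
      simp only [Real.ofDigitsTerm, heq i (Finset.mem_range.1 hi)]
  rw [Real.ofDigits_two_step (fun i => d (i + a))] at e
  rw [Real.ofDigits_two_step (fun i => d' (i + a))] at e'
  simp only [zero_add, hd, hd', Fin.val_zero, Fin.val_one, Nat.cast_zero, Nat.cast_one] at e e'
  set v := Real.ofDigits fun n => d (n + 1 + a)
  set v' := Real.ofDigits fun n => d' (n + 1 + a)
  have hvv : (1 / 2 : ℝ) ^ (t - a - 1 + 1) ≤ 1 + v' - v := by
    have hidx : t - a - 1 + 1 + a = t := by omega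
    rcases (show d t = 0 ∨ d t = 1 by omega) with h | h
    · have h1 := ofDigits_le_one_sub_half_pow (d := fun n => d (n + 1 + a)) (t := t - a - 1)
        (by rw [hidx, h])
      have h2 : 0 ≤ v' := Real.ofDigits_nonneg _
      linarith
    · have h1 := half_pow_le_ofDigits (d := fun n => d' (n + 1 + a)) (t := t - a - 1)
        (by rw [hidx, ← ht, h])
      have h2 : v ≤ 1 := Real.ofDigits_le_one _
      linarith
  have hpow : (1 / 2 : ℝ) ^ (t + 1) = (1 / 2) ^ a * ((1 / 2) ^ (t - a - 1 + 1) / 2) := by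
    rw [show t + 1 = a + (t - a - 1 + 1 + 1) by omega, pow_add, pow_succ]; ring
  have h2 : ((((2 : ℕ) : ℝ)) ^ a)⁻¹ = (1 / 2) ^ a := by simp
  rw [h2] at e e'
  rw [Real.dist_eq, abs_sub_comm, hpow]
  refine le_trans ?_ (le_abs_self _)
  have := mul_le_mul_of_nonneg_left hvv (by positivity : (0 : ℝ) ≤ (1 / 2) ^ a)
  linarith

open scoped ENNReal NNReal in
/-- A set that contains a point for every infinite word, such that words first differing at the
place `k` give points at distance at least `(1/2) ^ (L * (k + 1))`, has positive dimension. -/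
theorem dimH_ne_zero_of_separated {S : Set (ℝ × ℝ)} {L : ℕ} (hL : 1 ≤ L)
    (f : (ℕ → Fin 2) → ℝ × ℝ) (hf : ∀ ω, f ω ∈ S)
    (hsep : ∀ ω ω' k, (∀ i < k, ω i = ω' i) → ω k ≠ ω' k →
      (1 / 2 : ℝ) ^ (L * (k + 1)) ≤ dist (f ω) (f ω')) : dimH S ≠ 0 := by
  have hex : ∀ ω ω' : ℕ → Fin 2, ω ≠ ω' → ∃ k, (∀ i < k, ω i = ω' i) ∧ ω k ≠ ω' k := by
    intro ω ω' hne
    classical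
    have h : ∃ k, ω k ≠ ω' k := Function.ne_iff.1 hne
    exact ⟨Nat.find h, fun i hi => not_not.1 (Nat.find_min h hi), Nat.find_spec h⟩
  have hinj : Function.Injective f := by
    intro ω ω' heq
    by_contra hne
    obtain ⟨k, h1, h2⟩ := hex ω ω' hne
    have := hsep ω ω' k h1 h2
    rw [heq, dist_self] at this
    exact absurd this (not_le.2 (by positivity))
  set g : ℝ × ℝ → ℝ := fun p => Real.ofDigits (Function.invFun f p)
  have hg : ∀ ω, g (f ω) = Real.ofDigits ω := fun ω => by
    simp only [g, Function.leftInverse_invFun hinj ω]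
  have hLpos : (0 : ℝ≥0) < 1 / L := by positivity
  -- The map from the point of `ω` to the number with digits `ω` is Hölder with exponent `1 / L` and
  -- covers `[0, 1]`, so dimension zero of `S` is impossible.
  have hhold : HolderOnWith 2 (1 / L) g (range f) := by
    rintro _ ⟨ω, rfl⟩ _ ⟨ω', rfl⟩
    rw [hg, hg]
    by_cases hne : ω = ω'
    · simp [hne]
    obtain ⟨k, h1, h2⟩ := hex ω ω' hne
    have hd : ((2⁻¹ : ℝ≥0∞) ^ (k + 1)) ^ (L : ℝ) ≤ edist (f ω) (f ω') := by
      rw [edist_dist, ENNReal.rpow_natCast, ← pow_mul, mul_comm]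
      refine le_trans (le_of_eq ?_) (ENNReal.ofReal_le_ofReal (hsep ω ω' k h1 h2))
      rw [ENNReal.ofReal_pow (by norm_num), one_div, ENNReal.ofReal_inv_of_pos (by norm_num)]
      simp
    calc edist (Real.ofDigits ω) (Real.ofDigits ω') ≤ (2⁻¹ : ℝ≥0∞) ^ k := edist_ofDigits_le h1
      _ = 2 * (2⁻¹ : ℝ≥0∞) ^ (k + 1) := by
          rw [pow_succ', ← mul_assoc, ENNReal.mul_inv_cancel (by simp) (by simp), one_mul]
      _ = 2 * (((2⁻¹ : ℝ≥0∞) ^ (k + 1)) ^ (L : ℝ)) ^ ((1 / L : ℝ≥0) : ℝ) := by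
          rw [← ENNReal.rpow_mul]
          have : (L : ℝ) * ((1 / L : ℝ≥0) : ℝ) = 1 := by
            have : (L : ℝ) ≠ 0 := by positivity
            push_cast
            field_simp
          rw [this, ENNReal.rpow_one]
      _ ≤ (2 : ℝ≥0) * edist (f ω) (f ω') ^ ((1 / L : ℝ≥0) : ℝ) := by
          push_cast
          gcongr
  intro hS
  have hle := hhold.dimH_image_le hLpos
  have hrange : dimH (range f) = 0 :=
    le_antisymm ((dimH_mono (range_subset_iff.2 hf)).trans_eq hS) zero_le
  have hsub : Icc (0 : ℝ) 1 ⊆ g '' range f := by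
    intro x hx
    obtain ⟨ω, -, hω⟩ := Real.ofDigits_SurjOn (b := 2) (by norm_num) hx
    exact ⟨f ω, mem_range_self ω, by rw [hg, hω]⟩
  have hone : dimH (Icc (0 : ℝ) 1) = 1 := by
    rw [Real.dimH_of_nonempty_interior (by rw [interior_Icc]; exact ⟨1 / 2, by norm_num⟩)]
    simp
  have := (dimH_mono hsub).trans hle
  rw [hone, hrange, ENNReal.zero_div] at this
  exact absurd this (by simp)

/-- If the survivor set of `H` has dimension zero, `H` is met by the orbit of some free
concatenation of two given distinct words of equal length (with a common last letter and a common
zero). -/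
theorem exists_splice_mem {H : Set (ℝ × ℝ)} (hH : dimH (survivorSet H) = 0) {L : ℕ}
    {U V : ℤ → Fin 2} (hne : ∃ r : ℤ, 0 ≤ r ∧ r < L ∧ U r ≠ V r) (hlast : U (L - 1) = V (L - 1))
    (hzero : ∃ r : ℤ, 0 ≤ r ∧ r < L ∧ U r = 0 ∧ V r = 0) :
    ∃ ω i, (rightValue (splice L U V ω) i, leftValue (splice L U V ω) i) ∈ H := by
  by_contra! hc
  obtain ⟨r₀, hr0, hrL, hU0, hV0⟩ := hzero
  have hL : 1 ≤ L := by omega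
  have hz : ∀ ω k, splice L U V ω (L * k + r₀) = 0 := fun ω k => by
    rw [splice_mul_add U V ω k hr0 hrL]
    split_ifs <;> assumption
  have hx : ∀ ω i, rightValue (splice L U V ω) i < 1 := fun ω i => by
    refine rightValue_lt_one (j := L * (i / L + 1) + r₀) ?_ (hz ω _)
    have := Int.emod_lt_of_pos i (show (0 : ℤ) < L by omega)
    have := Int.mul_ediv_add_emod i L
    rw [mul_add]
    omega
  have hy : ∀ ω i, leftValue (splice L U V ω) i < 1 := fun ω i => by
    refine leftValue_lt_one (j := L * (i / L - 1) + r₀) ?_ (hz ω _)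
    have := Int.emod_nonneg i (show (L : ℤ) ≠ 0 by omega)
    have := Int.mul_ediv_add_emod i L
    rw [mul_sub]
    omega
  have hsurv : ∀ ω, (rightValue (splice L U V ω) (-1), leftValue (splice L U V ω) (-1)) ∈
      survivorSet H := fun ω =>
    mem_survivorSet_of_forall_notMem (hx ω) (hy ω) (hc ω) (-1)
  -- Index `-1` makes the right half start with the word number zero; the choices at negative places
  -- are immaterial and copied from place zero.
  refine dimH_ne_zero_of_separated hL (fun ω => (rightValue (splice L U V fun k => ω k.toNat) (-1),
    leftValue (splice L U V fun k => ω k.toNat) (-1))) (fun ω => hsurv _) ?_ hH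
  intro ω ω' k heq hk
  refine le_trans ?_ (le_max_left _ _)
  simp only [rightValue]
  have hdig : ∀ (ω : ℕ → Fin 2) (j : ℕ) (r : ℕ), r < L →
      splice L U V (fun k => ω k.toNat) (-1 + 1 + ((L * j + r : ℕ) : ℤ)) =
        if ω j = 1 then V r else U r := by
    intro ω j r hr
    have := splice_mul_add (L := L) U V (fun k => ω k.toNat) j (r := r) (by omega) (by omega)
    rw [show (-1 + 1 + ((L * j + r : ℕ) : ℤ)) = L * j + r by push_cast; ring, this]
    simp
  classical
  have hne' : ∃ r : ℕ, r < L ∧ U r ≠ V r := by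
    obtain ⟨r, h1, h2, h3⟩ := hne
    exact ⟨r.toNat, by omega, by rwa [Int.toNat_of_nonneg h1]⟩
  obtain ⟨hr1, hr2⟩ := Nat.find_spec hne'
  have hmin : ∀ i < Nat.find hne', U i = V i := fun i hi => by
    have := Nat.find_min hne' hi
    push Not at this
    exact this (by omega)
  generalize Nat.find hne' = r at hr1 hr2 hmin
  have hrlast : r < L - 1 := by
    by_contra! hcon
    obtain rfl : r = L - 1 := by omega
    rw [Nat.cast_sub hL] at hr2
    exact hr2 hlast
  -- The common last letter of the word where the choices first differ rules out the near
  -- coincidence of `0111…` and `1000…`, which bounds the distance below.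
  have := le_dist_ofDigits (d := fun n : ℕ => splice L U V (fun k => ω k.toNat) (-1 + 1 + n))
    (d' := fun n : ℕ => splice L U V (fun k => ω' k.toNat) (-1 + 1 + n)) (a := L * k + r)
    (t := L * k + (L - 1)) (by omega) ?_ ?_ ?_
  · rwa [show L * k + (L - 1) + 1 = L * (k + 1) by rw [mul_add]; omega] at this
  · intro i hi
    have hi' := Nat.div_add_mod i L
    have hm : i % L < L := Nat.mod_lt _ hL
    rw [← hi', hdig ω _ _ hm, hdig ω' _ _ hm]
    rcases lt_trichotomy (i / L) k with h | h | h
    · rw [heq _ h]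
    · rw [h] at hi'
      rw [hmin (i % L) (by omega)]
      simp
    · have := Nat.mul_le_mul_left L (Nat.succ_le_of_lt h)
      rw [Nat.mul_succ] at this
      omega
  · rw [hdig ω _ _ hr1, hdig ω' _ _ hr1]
    rcases (show ω k = 0 ∨ ω k = 1 by omega) with h | h <;>
      rcases (show ω' k = 0 ∨ ω' k = 1 by omega) with h' | h'
    · exact absurd (h.trans h'.symm) hk
    · simpa [h, h'] using hr2
    · simpa [h, h'] using hr2.symm
    · exact absurd (h.trans h'.symm) hk
  · rw [hdig ω _ _ (by omega), hdig ω' _ _ (by omega), Nat.cast_sub hL, Nat.cast_one, hlast]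
    simp

/-! ### Points in the closure of a dimension trap -/

theorem letters_of_mem_bigDelta {s : ℤ → Fin 2} {i : ℤ}
    (h : (rightValue s i, leftValue s i) ∈ bigDelta) : s i = 1 ∧ s (i + 1) = 0 := by
  rw [bigDelta_eq] at h
  obtain ⟨h1, h2, h3, h4⟩ := h
  dsimp only at h1 h2 h3 h4
  constructor
  · by_contra hc
    have e := leftValue_step s i
    rw [show s i = 0 by omega] at e
    simp only [Fin.val_zero, Nat.cast_zero, zero_add] at e
    linarith [leftValue_le_one s (i - 1)]
  · by_contra hc
    have e := rightValue_step s i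
    rw [show s (i + 1) = 1 by omega] at e
    simp only [Fin.val_one, Nat.cast_one] at e
    linarith [rightValue_nonneg s (i + 1)]

theorem mem_closure_of_forall_half_pow {H : Set (ℝ × ℝ)} {x y : ℝ}
    (h : ∀ N : ℕ, ∃ P ∈ H, |P.1 - x| ≤ (1 / 2) ^ N ∧ |P.2 - y| ≤ (1 / 2) ^ N) :
    (x, y) ∈ closure H := by
  rw [Metric.mem_closure_iff]
  intro ε hε
  obtain ⟨N, hN⟩ := exists_pow_lt_of_lt_one hε (by norm_num : (1 / 2 : ℝ) < 1)
  obtain ⟨P, hP, h1, h2⟩ := h N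
  refine ⟨P, hP, ?_⟩
  rw [dist_comm, Prod.dist_eq, Real.dist_eq, Real.dist_eq]
  exact max_lt (h1.trans_lt hN) (h2.trans_lt hN)

theorem rightValue_le_of_zeros {s : ℤ → Fin 2} {i : ℤ} {n : ℕ}
    (h : ∀ j, i < j → j ≤ i + n → s j = 0) : rightValue s i ≤ (1 / 2) ^ n := by
  rw [rightValue_of_zeros h]
  exact mul_le_of_le_one_right (by positivity) (rightValue_le_one _ _)

theorem leftValue_le_of_zeros {s : ℤ → Fin 2} {i : ℤ} {n : ℕ}
    (h : ∀ j, i - n < j → j ≤ i → s j = 0) : leftValue s i ≤ (1 / 2) ^ n := by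
  rw [leftValue_of_zeros h]
  exact mul_le_of_le_one_right (by positivity) (leftValue_le_one _ _)

theorem le_rightValue_of_ones {s : ℤ → Fin 2} {i : ℤ} {n : ℕ}
    (h : ∀ j, i < j → j ≤ i + n → s j = 1) : 1 - (1 / 2) ^ n ≤ rightValue s i := by
  rw [rightValue_of_ones h]
  have : ((1 : ℝ) / 2) ^ n * (1 - rightValue s (i + n)) ≤ (1 / 2) ^ n :=
    mul_le_of_le_one_right (by positivity) (by linarith [rightValue_nonneg s (i + n)])
  linarith

theorem le_leftValue_of_ones {s : ℤ → Fin 2} {i : ℤ} {n : ℕ}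
    (h : ∀ j, i - n < j → j ≤ i → s j = 1) : 1 - (1 / 2) ^ n ≤ leftValue s i := by
  rw [leftValue_of_ones h]
  have : ((1 : ℝ) / 2) ^ n * (1 - leftValue s (i - n)) ≤ (1 / 2) ^ n :=
    mul_le_of_le_one_right (by positivity) (by linarith [leftValue_nonneg s (i - n)])
  linarith

section Corners

variable {H : Set (ℝ × ℝ)} (hH : dimH (survivorSet H) = 0) (hsub : H ⊆ bigDelta)

include hH hsub

theorem zero_one_mem_closure : ((0 : ℝ), (1 : ℝ)) ∈ closure H := by
  refine mem_closure_of_forall_half_pow fun N => ?_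
  -- The words are `1^(N+1) 0^(N+2)` and `1^(N+2) 0^(N+1)`: every `10` is preceded by a long run of
  -- ones and followed by a long run of zeros.
  set U : ℤ → Fin 2 := fun r => if r < N + 1 then 1 else 0 with hU
  set V : ℤ → Fin 2 := fun r => if r < N + 2 then 1 else 0 with hV
  obtain ⟨ω, i, hi⟩ := exists_splice_mem hH (L := 2 * N + 3) (U := U) (V := V)
    ⟨N + 1, by omega, by push_cast; omega, by simp [hU, hV]⟩
    (by
      rw [hU, hV]; beta_reduce
      rw [if_neg (by push_cast; omega), if_neg (by push_cast; omega)])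
    ⟨2 * N + 2, by omega, by push_cast; omega, by
      rw [hU]; beta_reduce; rw [if_neg (by omega)], by
      rw [hV]; beta_reduce; rw [if_neg (by omega)]⟩
  refine ⟨_, hi, ?_⟩
  obtain ⟨s1, s2⟩ := letters_of_mem_bigDelta (hsub hi)
  obtain ⟨k, r, hr0, hrL, rfl⟩ : ∃ k r : ℤ, 0 ≤ r ∧ r < 2 * N + 3 ∧ i = (2 * N + 3) * k + r :=
    ⟨i / (2 * N + 3), i % (2 * N + 3), Int.emod_nonneg _ (by omega),
      Int.emod_lt_of_pos _ (by omega), (Int.mul_ediv_add_emod _ _).symm⟩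
  have happ : ∀ r' : ℤ, 0 ≤ r' → r' < 2 * N + 3 →
      splice (2 * N + 3 : ℕ) U V ω ((2 * N + 3) * k + r') = if ω k = 1 then V r' else U r' := by
    intro r' h1 h2
    have := splice_mul_add (L := (2 * N + 3 : ℕ)) U V ω k h1 (by push_cast; omega)
    rw [← this]; push_cast; rfl
  rw [happ r hr0 hrL] at s1
  have hrN : r < N + 2 := by
    by_contra hc
    split_ifs at s1
    · simp only [hV, if_neg hc] at s1; omega
    · simp only [hU, if_neg (show ¬ r < N + 1 by omega)] at s1; omega
  have hrN' : (N : ℤ) ≤ r := by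
    by_contra hc
    rw [add_assoc, happ (r + 1) (by omega) (by omega)] at s2
    split_ifs at s2
    · simp only [hV, if_pos (show r + 1 < (N : ℤ) + 2 by omega)] at s2; omega
    · simp only [hU, if_pos (show r + 1 < (N : ℤ) + 1 by omega)] at s2; omega
  have hx := rightValue_le_of_zeros (s := splice (2 * N + 3 : ℕ) U V ω)
    (i := (2 * N + 3) * k + r) (n := N) (by
      intro j j1 j2
      obtain ⟨t, rfl⟩ : ∃ t, j = (2 * N + 3) * k + t := ⟨j - (2 * N + 3) * k, by ring⟩
      rw [happ t (by omega) (by omega)]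
      split_ifs with hω
      · rw [if_pos hω] at s1
        by_cases htr : t < N + 2
        · exfalso
          rw [add_assoc, happ (r + 1) (by omega) (by omega), if_pos hω, hV] at s2
          beta_reduce at s2
          rw [if_pos (by omega)] at s2
          omega
        · simp only [hV, if_neg htr]
      · simp only [hU, if_neg (show ¬ t < (N : ℤ) + 1 by omega)])
  have hy := le_leftValue_of_ones (s := splice (2 * N + 3 : ℕ) U V ω)
    (i := (2 * N + 3) * k + r) (n := N) (by
      intro j j1 j2
      obtain ⟨t, rfl⟩ : ∃ t, j = (2 * N + 3) * k + t := ⟨j - (2 * N + 3) * k, by ring⟩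
      rw [happ t (by omega) (by omega)]
      split_ifs with hω
      · simp only [hV, if_pos (show t < (N : ℤ) + 2 by omega)]
      · rw [if_neg hω] at s1
        by_cases htr : r < N + 1
        · simp only [hU, if_pos (show t < (N : ℤ) + 1 by omega)]
        · simp only [hU, if_neg htr] at s1
          omega)
  constructor
  · rw [sub_zero, abs_of_nonneg (rightValue_nonneg _ _)]
    exact hx
  · have hone := leftValue_le_one (splice ((2 * N + 3 : ℕ) : ℤ) U V ω) ((2 * N + 3) * k + r)
    have hpos : (0 : ℝ) < (1 / 2) ^ N := by positivity
    rw [abs_le]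
    constructor <;> dsimp only <;> linarith

theorem zero_half_mem_closure : ((0 : ℝ), (1 / 2 : ℝ)) ∈ closure H := by
  refine mem_closure_of_forall_half_pow fun N => ?_
  -- All ones lie at multiples of `N + 2`, so each is surrounded by zeros and its point is close to
  -- `(0, 1/2)`.
  set U : ℤ → Fin 2 := fun r => if r = 0 then 1 else 0 with hU
  set V : ℤ → Fin 2 := fun r => if r = 0 ∨ r = N + 2 then 1 else 0 with hV
  obtain ⟨ω, i, hi⟩ := exists_splice_mem hH (L := 2 * (N + 2)) (U := U) (V := V)
    ⟨N + 2, by omega, by push_cast; omega, by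
      simp [hU, hV, show (N : ℤ) + 2 ≠ 0 by omega]⟩
    (by
      simp only [hU, hV]
      rw [if_neg (by push_cast; omega), if_neg (by push_cast; omega)])
    ⟨1, by omega, by push_cast; omega, by simp [hU], by
      simp only [hV]; rw [if_neg (by omega)]⟩
  refine ⟨_, hi, ?_⟩
  have hP := hsub hi
  rw [bigDelta_eq] at hP
  obtain ⟨-, -, hP3, -⟩ := hP
  obtain ⟨s1, s2⟩ := letters_of_mem_bigDelta (hsub hi)
  have hdvd : ∀ j, splice (2 * (N + 2) : ℕ) U V ω j = 1 → j % (N + 2 : ℤ) = 0 := by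
    intro j hj
    have hd : j % ((2 * (N + 2) : ℕ) : ℤ) = 0 ∨ j % ((2 * (N + 2) : ℕ) : ℤ) = N + 2 := by
      by_contra! hc
      simp only [splice, hU, hV, if_neg hc.1, if_neg (not_or.2 hc), ite_self] at hj
      omega
    rw [← Int.emod_emod_of_dvd j (show (N + 2 : ℤ) ∣ ((2 * (N + 2) : ℕ) : ℤ) from
      ⟨2, by push_cast; ring⟩)]
    rcases hd with hd | hd <;> rw [hd] <;> simp
  have hi0 := hdvd i s1
  have hzero : ∀ j, j ≠ i → i - (N + 2) < j → j < i + (N + 2) →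
      splice (2 * (N + 2) : ℕ) U V ω j = 0 := by
    intro j hj h1 h2
    by_contra hc
    have := hdvd j (by omega)
    obtain ⟨a, ha⟩ := Int.dvd_of_emod_eq_zero hi0
    obtain ⟨b, hb⟩ := Int.dvd_of_emod_eq_zero this
    have hab : a ≠ b := by rintro rfl; exact hj (hb.trans ha.symm)
    rcases lt_or_gt_of_ne hab with h | h
    · have := mul_le_mul_of_nonneg_left (show a + 1 ≤ b by omega) (show (0 : ℤ) ≤ N + 2 by omega)
      rw [mul_add] at this
      omega
    · have := mul_le_mul_of_nonneg_left (show b + 1 ≤ a by omega) (show (0 : ℤ) ≤ N + 2 by omega)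
      rw [mul_add] at this
      omega
  have hx := rightValue_le_of_zeros (s := splice (2 * (N + 2) : ℕ) U V ω) (i := i) (n := N)
    fun j j1 j2 => hzero j (by omega) (by omega) (by omega)
  have hy := leftValue_le_of_zeros (s := splice (2 * (N + 2) : ℕ) U V ω) (i := i - 1) (n := N)
    fun j j1 j2 => hzero j (by omega) (by omega) (by omega)
  have e := leftValue_step (splice (2 * (N + 2) : ℕ) U V ω) i
  rw [s1] at e
  simp only [Fin.val_one, Nat.cast_one] at e
  have hpos : (0 : ℝ) < (1 / 2) ^ N := by positivity
  have := leftValue_nonneg (splice (2 * (N + 2) : ℕ) U V ω) (i - 1)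
  constructor
  · rw [sub_zero, abs_of_nonneg (rightValue_nonneg _ _)]
    exact hx
  · rw [abs_le]
    constructor <;> dsimp only <;> linarith

theorem half_one_mem_closure : ((1 / 2 : ℝ), (1 : ℝ)) ∈ closure H := by
  refine mem_closure_of_forall_half_pow fun N => ?_
  -- Now the zeros are sparse, and the points at `10` are close to `(1/2, 1)`.
  set U : ℤ → Fin 2 := fun r => if r = 0 then 0 else 1 with hU
  set V : ℤ → Fin 2 := fun r => if r = 0 ∨ r = N + 2 then 0 else 1 with hV
  obtain ⟨ω, i, hi⟩ := exists_splice_mem hH (L := 2 * (N + 2)) (U := U) (V := V)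
    ⟨N + 2, by omega, by push_cast; omega, by
      simp [hU, hV, show (N : ℤ) + 2 ≠ 0 by omega]⟩
    (by
      simp only [hU, hV]
      rw [if_neg (by push_cast; omega), if_neg (by push_cast; omega)])
    ⟨0, by omega, by push_cast; omega, by simp [hU], by simp [hV]⟩
  refine ⟨_, hi, ?_⟩
  obtain ⟨s1, s2⟩ := letters_of_mem_bigDelta (hsub hi)
  have hdvd : ∀ j, splice (2 * (N + 2) : ℕ) U V ω j = 0 → j % (N + 2 : ℤ) = 0 := by
    intro j hj
    have hd : j % ((2 * (N + 2) : ℕ) : ℤ) = 0 ∨ j % ((2 * (N + 2) : ℕ) : ℤ) = N + 2 := by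
      by_contra! hc
      simp only [splice, hU, hV, if_neg hc.1, if_neg (not_or.2 hc), ite_self] at hj
      omega
    rw [← Int.emod_emod_of_dvd j (show (N + 2 : ℤ) ∣ ((2 * (N + 2) : ℕ) : ℤ) from
      ⟨2, by push_cast; ring⟩)]
    rcases hd with hd | hd <;> rw [hd] <;> simp
  have hi0 := hdvd (i + 1) s2
  have hone : ∀ j, j ≠ i + 1 → i + 1 - (N + 2) < j → j < i + 1 + (N + 2) →
      splice (2 * (N + 2) : ℕ) U V ω j = 1 := by
    intro j hj h1 h2
    by_contra hc
    have := hdvd j (by omega)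
    obtain ⟨a, ha⟩ := Int.dvd_of_emod_eq_zero hi0
    obtain ⟨b, hb⟩ := Int.dvd_of_emod_eq_zero this
    have hab : a ≠ b := by rintro rfl; exact hj (hb.trans ha.symm)
    rcases lt_or_gt_of_ne hab with h | h
    · have := mul_le_mul_of_nonneg_left (show a + 1 ≤ b by omega) (show (0 : ℤ) ≤ N + 2 by omega)
      rw [mul_add] at this
      omega
    · have := mul_le_mul_of_nonneg_left (show b + 1 ≤ a by omega) (show (0 : ℤ) ≤ N + 2 by omega)
      rw [mul_add] at this
      omega
  have hx := le_rightValue_of_ones (s := splice (2 * (N + 2) : ℕ) U V ω) (i := i + 1) (n := N)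
    fun j j1 j2 => hone j (by omega) (by omega) (by omega)
  have hy := le_leftValue_of_ones (s := splice (2 * (N + 2) : ℕ) U V ω) (i := i) (n := N)
    fun j j1 j2 => hone j (by omega) (by omega) (by omega)
  have e := rightValue_step (splice (2 * (N + 2) : ℕ) U V ω) i
  rw [s2] at e
  simp only [Fin.val_zero, Nat.cast_zero, zero_add] at e
  have hpos : (0 : ℝ) < (1 / 2) ^ N := by positivity
  have := rightValue_le_one (splice (2 * (N + 2) : ℕ) U V ω) (i + 1)
  have := leftValue_le_one (splice (2 * (N + 2) : ℕ) U V ω) i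
  constructor <;> rw [abs_le] <;> constructor <;> dsimp only <;> linarith

end Corners

/-! ### Perturbations of the alternating sequence -/

theorem leftValue_sub_of_alternating {s : ℤ → Fin 2} {i : ℤ} {a : ℕ}
    (h : ∀ t : ℕ, t < a → s (i - 2 * t) = 1 ∧ s (i - 2 * t - 1) = 0) :
    leftValue s i - 2 / 3 = (1 / 4) ^ a * (leftValue s (i - 2 * a) - 2 / 3) := by
  induction a with
  | zero => simp
  | succ a ih =>
    obtain ⟨h1, h2⟩ := h a (by omega)
    rw [ih fun t ht => h t (by omega), leftValue_step s (i - 2 * a),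
      leftValue_step s (i - 2 * a - 1), h1, h2,
      show i - 2 * (a : ℤ) - 1 - 1 = i - 2 * ((a + 1 : ℕ) : ℤ) by push_cast; ring]
    push_cast
    simp only [Fin.val_zero, Fin.val_one, Nat.cast_zero, Nat.cast_one]
    ring

theorem rightValue_sub_of_alternating {s : ℤ → Fin 2} {i : ℤ} {a : ℕ}
    (h : ∀ t : ℕ, t < a → s (i + 2 * t + 1) = 0 ∧ s (i + 2 * t + 1 + 1) = 1) :
    rightValue s i - 1 / 3 = (1 / 4) ^ a * (rightValue s (i + 2 * a) - 1 / 3) := by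
  induction a with
  | zero => simp
  | succ a ih =>
    obtain ⟨h1, h2⟩ := h a (by omega)
    rw [ih fun t ht => h t (by omega), rightValue_step s (i + 2 * a),
      rightValue_step s (i + 2 * a + 1), h1, h2,
      show i + 2 * (a : ℤ) + 1 + 1 = i + 2 * ((a + 1 : ℕ) : ℤ) by push_cast; ring]
    simp only [Fin.val_zero, Fin.val_one, Nat.cast_zero, Nat.cast_one]
    ring

/-- A sequence that alternates except that some of the blocks of length `4 * N + 8` start with
`0011` instead of `0101`. -/
structure IsSwitchedAlternating (N : ℕ) (ω : ℤ → Fin 2) (s : ℤ → Fin 2) : Prop where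
  even : ∀ k t : ℤ, 0 ≤ t → t < 2 * N + 4 → t ≠ 1 → s ((4 * N + 8) * k + 2 * t) = 0
  odd : ∀ k t : ℤ, 1 ≤ t → t < 2 * N + 4 → s ((4 * N + 8) * k + 2 * t + 1) = 1
  one : ∀ k : ℤ, s ((4 * N + 8) * k + 1) = if ω k = 1 then 0 else 1
  two : ∀ k : ℤ, s ((4 * N + 8) * k + 2) = if ω k = 1 then 1 else 0

namespace IsSwitchedAlternating

variable {N : ℕ} {ω s : ℤ → Fin 2} (hs : IsSwitchedAlternating N ω s)

include hs

theorem abs_leftValue_sub_le (k : ℤ) :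
    |leftValue s ((4 * N + 8) * k - 1) - 2 / 3| ≤ (1 / 4) ^ (2 * N + 2) := by
  rw [leftValue_sub_of_alternating (a := 2 * N + 2) fun t ht => ⟨?_, ?_⟩, abs_mul,
    abs_of_pos (by positivity)]
  · refine mul_le_of_le_one_right (by positivity) ?_
    rw [abs_le]
    constructor <;> linarith [leftValue_nonneg s ((4 * N + 8) * k - 1 - 2 * (2 * N + 2 : ℕ)),
      leftValue_le_one s ((4 * N + 8) * k - 1 - 2 * (2 * N + 2 : ℕ))]
  · rw [← hs.odd (k - 1) (2 * N + 3 - t) (by omega) (by omega)]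
    congr 1; ring
  · rw [← hs.even (k - 1) (2 * N + 3 - t) (by omega) (by omega) (by omega)]
    congr 1; ring

theorem abs_rightValue_sub_le (k : ℤ) :
    |rightValue s ((4 * N + 8) * k + 3) - 1 / 3| ≤ (1 / 4) ^ (2 * N + 2) := by
  rw [rightValue_sub_of_alternating (a := 2 * N + 2) fun t ht => ⟨?_, ?_⟩, abs_mul,
    abs_of_pos (by positivity)]
  · refine mul_le_of_le_one_right (by positivity) ?_
    rw [abs_le]
    constructor <;> linarith [rightValue_nonneg s ((4 * N + 8) * k + 3 + 2 * (2 * N + 2 : ℕ)),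
      rightValue_le_one s ((4 * N + 8) * k + 3 + 2 * (2 * N + 2 : ℕ))]
  · rw [← hs.even k (t + 2) (by omega) (by omega) (by omega)]
    congr 1; ring
  · rw [← hs.odd k (t + 2) (by omega) (by omega)]
    congr 1; ring

theorem leftValue_add_three {k : ℤ} (hk : ω k = 1) :
    leftValue s ((4 * N + 8) * k + 3) - 2 / 3 =
      1 / 8 + (leftValue s ((4 * N + 8) * k - 1) - 2 / 3) / 16 := by
  have h0 := hs.even k 0 le_rfl (by omega) (by omega)
  have h1 := hs.one k
  have h2 := hs.two k
  have h3 := hs.odd k 1 le_rfl (by omega)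
  rw [if_pos hk] at h1 h2
  rw [mul_zero, add_zero] at h0
  rw [mul_one, add_assoc] at h3
  rw [leftValue_step s (_ + 3), show (4 * N + 8) * k + 3 - 1 = (4 * N + 8) * k + 2 by ring,
    leftValue_step s (_ + 2), show (4 * N + 8) * k + 2 - 1 = (4 * N + 8) * k + 1 by ring,
    leftValue_step s (_ + 1), show (4 * N + 8) * k + 1 - 1 = (4 * N + 8) * k by ring,
    leftValue_step s ((4 * N + 8) * k), h0, h1, h2, show (3 : ℤ) = 2 + 1 by rfl, h3]
  simp only [Fin.val_zero, Fin.val_one, Nat.cast_zero, Nat.cast_one]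
  ring

/-- The shift `-1/8` is `0.0011 - 0.0101` in base 2; read from the other side, the switch
contributes `0.1100 - 0.1010 = 1/8`, whence the end points `5/24` and `19/24`. -/
theorem rightValue_sub_one (k : ℤ) :
    rightValue s ((4 * N + 8) * k - 1) - 1 / 3 =
      (if ω k = 1 then -1 / 8 else 0) + (rightValue s ((4 * N + 8) * k + 3) - 1 / 3) / 16 := by
  have h0 := hs.even k 0 le_rfl (by omega) (by omega)
  have h1 := hs.one k
  have h2 := hs.two k
  have h3 := hs.odd k 1 le_rfl (by omega)
  rw [mul_zero, add_zero] at h0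
  rw [mul_one, add_assoc, show (2 : ℤ) + 1 = 3 by rfl] at h3
  rw [rightValue_step s (_ - 1), show (4 * N + 8) * k - 1 + 1 = (4 * N + 8) * k by ring,
    rightValue_step s ((4 * N + 8) * k), rightValue_step s (_ + 1),
    show (4 * N + 8) * k + 1 + 1 = (4 * N + 8) * k + 2 by ring,
    rightValue_step s (_ + 2), show (4 * N + 8) * k + 2 + 1 = (4 * N + 8) * k + 3 by ring,
    h0, h1, h2, h3]
  split_ifs <;> simp only [Fin.val_zero, Fin.val_one, Nat.cast_zero, Nat.cast_one] <;> ring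

/-- The part of an orbit of a switched alternating sequence that lies in `Δ` is close to the union
of the segments from `(1/3, 2/3)` to `(1/3, 19/24)` and to `(5/24, 2/3)`. -/
theorem bounds {i : ℤ} (h1 : s i = 1) (h2 : s (i + 1) = 0) :
    (-1 / 8 - (1 / 4) ^ N ≤ rightValue s i - 1 / 3 ∧ rightValue s i - 1 / 3 ≤ (1 / 4) ^ N) ∧
    (-(1 / 4) ^ N ≤ leftValue s i - 2 / 3 ∧ leftValue s i - 2 / 3 ≤ 1 / 8 + (1 / 4) ^ N) ∧
    (|rightValue s i - 1 / 3| ≤ (1 / 4) ^ N ∨ |leftValue s i - 2 / 3| ≤ (1 / 4) ^ N) := by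
  obtain ⟨k, r, hr0, hrL, rfl⟩ : ∃ k r : ℤ, 0 ≤ r ∧ r < 4 * N + 8 ∧ i = (4 * N + 8) * k + r :=
    ⟨i / (4 * N + 8), i % (4 * N + 8), Int.emod_nonneg _ (by omega),
      Int.emod_lt_of_pos _ (by omega), (Int.mul_ediv_add_emod _ _).symm⟩
  obtain ⟨u, rfl⟩ : ∃ u, r = 2 * u + 1 := by
    rcases Int.even_or_odd' r with ⟨u, rfl | rfl⟩
    · exfalso
      by_cases hu : u = 1
      · subst hu
        have := hs.odd k 1 le_rfl (by omega)
        rw [this] at h2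
        omega
      · rw [hs.even k u (by omega) (by omega) hu] at h1
        omega
    · exact ⟨u, rfl⟩
  rw [← add_assoc] at h1 h2 ⊢
  have hu1 : ω k = 1 → 1 ≤ u := by
    intro hk
    by_contra hc
    obtain rfl : u = 0 := by omega
    rw [mul_zero, add_zero, hs.one k, if_pos hk] at h1
    omega
  obtain ⟨b, hb⟩ : ∃ b : ℕ, (b : ℤ) = 2 * N + 3 - u :=
    ⟨(2 * N + 3 - u).toNat, Int.toNat_of_nonneg (by omega)⟩
  have hδ : ((1 : ℝ) / 4) ^ (2 * N + 2) ≤ (1 / 4) ^ N / 16 := by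
    rw [show 2 * N + 2 = N + N + 2 by ring, pow_add, pow_add]
    have : ((1 : ℝ) / 4) ^ N * (1 / 4) ^ N ≤ (1 / 4) ^ N :=
      mul_le_of_le_one_right (by positivity) (pow_le_one₀ (by norm_num) (by norm_num))
    linarith
  have hη : (0 : ℝ) < (1 / 4) ^ N := by positivity
  have hR := rightValue_sub_of_alternating (s := s) (i := (4 * N + 8) * k + 2 * u + 1) (a := b)
    fun t ht => ⟨by
      by_cases ht0 : u + t + 1 = 1
      · have hk : ω k ≠ 1 := fun hk => by have := hu1 hk; omega
        have := hs.two k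
        rw [if_neg hk] at this
        rw [← this]
        congr 1; linear_combination 2 * ht0
      · rw [← hs.even k (u + t + 1) (by omega) (by omega) ht0]
        congr 1; ring, by
      rw [← hs.odd k (u + t + 1) (by omega) (by omega)]
      congr 1; ring⟩
  rw [show (4 * N + 8) * k + 2 * u + 1 + 2 * (b : ℤ) = (4 * N + 8) * (k + 1) - 1 by
    rw [hb]; ring, hs.rightValue_sub_one] at hR
  have hX := abs_le.1 (hs.abs_rightValue_sub_le (k + 1))
  set X := rightValue s ((4 * N + 8) * (k + 1) + 3) - 1 / 3
  have hb0 : (0 : ℝ) < (1 / 4) ^ b := by positivity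
  have hb1 : ((1 : ℝ) / 4) ^ b ≤ 1 := pow_le_one₀ (by norm_num) (by norm_num)
  have hx1 : -((1 / 4) ^ b / 8) - (1 / 4) ^ N / 16 ≤
      rightValue s ((4 * N + 8) * k + 2 * u + 1) - 1 / 3 := by
    rw [hR]
    split_ifs <;> nlinarith
  have hx2 : rightValue s ((4 * N + 8) * k + 2 * u + 1) - 1 / 3 ≤ (1 / 4) ^ N / 16 := by
    rw [hR]
    split_ifs <;> nlinarith
  have hY := abs_le.1 (hs.abs_leftValue_sub_le k)
  refine ⟨⟨by linarith, by linarith⟩, ?_⟩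
  by_cases hk : ω k = 1
  · obtain ⟨a, ha⟩ : ∃ a : ℕ, (a : ℤ) = u - 1 :=
      ⟨(u - 1).toNat, Int.toNat_of_nonneg (by linarith [hu1 hk])⟩
    have hL := leftValue_sub_of_alternating (s := s) (i := (4 * N + 8) * k + 2 * u + 1) (a := a)
      fun t ht => ⟨by
        rw [← hs.odd k (u - t) (by omega) (by omega)]
        congr 1; ring, by
        rw [← hs.even k (u - t) (by omega) (by omega) (by omega)]
        congr 1; ring⟩
    rw [show (4 * N + 8) * k + 2 * u + 1 - 2 * (a : ℤ) = (4 * N + 8) * k + 3 by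
      rw [ha]; ring, hs.leftValue_add_three hk] at hL
    set Y := leftValue s ((4 * N + 8) * k - 1) - 2 / 3
    have ha0 : (0 : ℝ) < (1 / 4) ^ a := by positivity
    have ha1 : ((1 : ℝ) / 4) ^ a ≤ 1 := pow_le_one₀ (by norm_num) (by norm_num)
    have hy1 : -((1 / 4) ^ N / 16) ≤ leftValue s ((4 * N + 8) * k + 2 * u + 1) - 2 / 3 := by
      rw [hL]; nlinarith
    have hy2 : leftValue s ((4 * N + 8) * k + 2 * u + 1) - 2 / 3 ≤
        (1 / 4) ^ a / 8 + (1 / 4) ^ N / 16 := by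
      rw [hL]; nlinarith
    refine ⟨⟨by linarith, by linarith⟩, ?_⟩
    -- The numbers of alternating pairs up to the switch on the left and to the next block on the
    -- right satisfy `a + b = 2 * N + 2`; hence at most one of the coordinates can feel a switch.
    rcases (show N ≤ a ∨ N ≤ b by omega) with h | h
    · have := pow_le_pow_of_le_one (by norm_num : (0 : ℝ) ≤ 1 / 4) (by norm_num) h
      exact .inr (abs_le.2 ⟨by linarith, by linarith⟩)
    · have := pow_le_pow_of_le_one (by norm_num : (0 : ℝ) ≤ 1 / 4) (by norm_num) h
      exact .inl (abs_le.2 ⟨by linarith, by linarith⟩)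
  · obtain ⟨a, ha⟩ : ∃ a : ℕ, (a : ℤ) = u + 1 :=
      ⟨(u + 1).toNat, Int.toNat_of_nonneg (by omega)⟩
    have hL := leftValue_sub_of_alternating (s := s) (i := (4 * N + 8) * k + 2 * u + 1) (a := a)
      fun t ht => ⟨by
        by_cases ht0 : u = t
        · have := hs.one k
          rw [if_neg hk] at this
          rw [← this]
          congr 1; linear_combination 2 * ht0
        · rw [← hs.odd k (u - t) (by omega) (by omega)]
          congr 1; ring, by
        by_cases ht0 : u - t = 1
        · have := hs.two k
          rw [if_neg hk] at this
          rw [← this]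
          congr 1; linear_combination 2 * ht0
        · rw [← hs.even k (u - t) (by omega) (by omega) ht0]
          congr 1; ring⟩
    rw [show (4 * N + 8) * k + 2 * u + 1 - 2 * (a : ℤ) = (4 * N + 8) * k - 1 by
      rw [ha]; ring] at hL
    set Y := leftValue s ((4 * N + 8) * k - 1) - 2 / 3
    have ha0 : (0 : ℝ) < (1 / 4) ^ a := by positivity
    have ha1 : ((1 : ℝ) / 4) ^ a ≤ 1 := pow_le_one₀ (by norm_num) (by norm_num)
    have hy1 : -((1 / 4) ^ N / 16) ≤ leftValue s ((4 * N + 8) * k + 2 * u + 1) - 2 / 3 := by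
      rw [hL]; nlinarith
    have hy2 : leftValue s ((4 * N + 8) * k + 2 * u + 1) - 2 / 3 ≤ (1 / 4) ^ N / 16 := by
      rw [hL]; nlinarith
    exact ⟨⟨by linarith, by linarith⟩, .inr (abs_le.2 ⟨by linarith, by linarith⟩)⟩

end IsSwitchedAlternating

theorem exists_mem_near_segments {H : Set (ℝ × ℝ)} (hH : dimH (survivorSet H) = 0)
    (hsub : H ⊆ bigDelta) (N : ℕ) : ∃ x y : ℝ, (1 / 3 + x, 2 / 3 + y) ∈ H ∧
      (-1 / 8 - (1 / 4) ^ N ≤ x ∧ x ≤ (1 / 4) ^ N) ∧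
      (-(1 / 4) ^ N ≤ y ∧ y ≤ 1 / 8 + (1 / 4) ^ N) ∧
      (|x| ≤ (1 / 4) ^ N ∨ |y| ≤ (1 / 4) ^ N) := by
  set U : ℤ → Fin 2 := fun r => if r % 2 = 1 then 1 else 0 with hU
  set V : ℤ → Fin 2 := fun r => if r = 1 then 0 else if r = 2 then 1 else
    if r % 2 = 1 then 1 else 0 with hV
  obtain ⟨ω, i, hi⟩ := exists_splice_mem hH (L := 4 * N + 8) (U := U) (V := V)
    ⟨1, by omega, by push_cast; omega, by simp [hU, hV]⟩
    (by
      simp only [hU, hV]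
      rw [if_neg (show ¬ ((4 * N + 8 : ℕ) : ℤ) - 1 = 1 by omega),
        if_neg (show ¬ ((4 * N + 8 : ℕ) : ℤ) - 1 = 2 by omega)])
    ⟨0, by omega, by push_cast; omega, by simp [hU], by simp [hV]⟩
  have happ : ∀ k r : ℤ, 0 ≤ r → r < 4 * N + 8 →
      splice (4 * N + 8 : ℕ) U V ω ((4 * N + 8) * k + r) = if ω k = 1 then V r else U r := by
    intro k r h1 h2
    have := splice_mul_add (L := (4 * N + 8 : ℕ)) U V ω k h1 (by push_cast; omega)
    rw [← this]; push_cast; rfl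
  have hs : IsSwitchedAlternating N ω (splice (4 * N + 8 : ℕ) U V ω) := by
    refine ⟨fun k t h0 ht h1 => ?_, fun k t h0 ht => ?_, fun k => ?_, fun k => ?_⟩
    · rw [happ k _ (by omega) (by omega)]
      simp only [hU, hV]
      rw [if_neg (show ¬ 2 * t = 1 by omega), if_neg (show ¬ 2 * t = 2 by omega),
        if_neg (show ¬ 2 * t % 2 = 1 by omega), ite_self]
    · rw [add_assoc, happ k _ (by omega) (by omega)]
      simp only [hU, hV]
      rw [if_neg (show ¬ 2 * t + 1 = 1 by omega), if_neg (show ¬ 2 * t + 1 = 2 by omega),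
        if_pos (show (2 * t + 1) % 2 = 1 by omega), ite_self]
    · rw [happ k _ (by omega) (by omega)]
      simp [hU, hV]
    · rw [happ k _ (by omega) (by omega)]
      simp [hU, hV]
  obtain ⟨s1, s2⟩ := letters_of_mem_bigDelta (hsub hi)
  exact ⟨_, _, by simpa using hi, hs.bounds s1 s2⟩

theorem exists_mem_closure_segments {H : Set (ℝ × ℝ)} (hH : dimH (survivorSet H) = 0)
    (hsub : H ⊆ bigDelta) :
    (∃ y : ℝ, 2 / 3 ≤ y ∧ y ≤ 19 / 24 ∧ (1 / 3, y) ∈ closure H) ∨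
      ∃ x : ℝ, 5 / 24 ≤ x ∧ x ≤ 1 / 3 ∧ (x, 2 / 3) ∈ closure H := by
  by_contra! hc
  obtain ⟨hc1, hc2⟩ := hc
  set K : Set (ℝ × ℝ) := {1 / 3} ×ˢ Icc (2 / 3) (19 / 24) ∪ Icc (5 / 24) (1 / 3) ×ˢ {2 / 3} with hK
  have hKc : IsCompact K :=
    (isCompact_singleton.prod isCompact_Icc).union (isCompact_Icc.prod isCompact_singleton)
  have hKH : K ⊆ (closure H)ᶜ := by
    rintro ⟨x, y⟩ (⟨rfl, h⟩ | ⟨h, rfl⟩)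
    · exact hc1 y h.1 h.2
    · exact hc2 x h.1 h.2
  -- If the closure missed both segments, compactness would keep it a distance `δ` away, against the
  -- points of `H` found within `(1/4) ^ N` of them.
  obtain ⟨δ, hδ, hsubset⟩ := hKc.exists_thickening_subset_open isClosed_closure.isOpen_compl hKH
  obtain ⟨N, hN⟩ := exists_pow_lt_of_lt_one hδ (by norm_num : (1 / 4 : ℝ) < 1)
  obtain ⟨x, y, hxy, ⟨hx1, hx2⟩, ⟨hy1, hy2⟩, hor⟩ := exists_mem_near_segments hH hsub N
  have hη : (0 : ℝ) < (1 / 4) ^ N := by positivity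
  refine hsubset (Metric.mem_thickening_iff.2 ?_) (subset_closure hxy)
  rcases hor with h | h
  · rw [abs_le] at h
    refine ⟨(1 / 3, 2 / 3 + max 0 (min y (1 / 8))), .inl ⟨rfl, ?_, ?_⟩, ?_⟩
    · linarith [le_max_left 0 (min y (1 / 8))]
    · have : max 0 (min y (1 / 8)) ≤ 1 / 8 := max_le (by norm_num) (min_le_right _ _)
      dsimp only; linarith
    · rw [Prod.dist_eq, Real.dist_eq, Real.dist_eq]
      refine lt_of_le_of_lt (max_le ?_ ?_) hN
      · rw [abs_le]; constructor <;> dsimp only <;> linarith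
      · dsimp only
        rw [abs_le]
        rcases max_cases 0 (min y (1 / 8)) with h1 | h1 <;>
          rcases min_cases y (1 / 8) with h2 | h2 <;> constructor <;> linarith
  · rw [abs_le] at h
    refine ⟨(1 / 3 + max (-1 / 8) (min x 0), 2 / 3), .inr ⟨⟨?_, ?_⟩, rfl⟩, ?_⟩
    · linarith [le_max_left (-1 / 8) (min x 0)]
    · have : max (-1 / 8) (min x 0) ≤ 0 := max_le (by norm_num) (min_le_right _ _)
      dsimp only; linarith
    · rw [Prod.dist_eq, Real.dist_eq, Real.dist_eq]
      refine lt_of_le_of_lt (max_le ?_ ?_) hN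
      · dsimp only
        rw [abs_le]
        rcases max_cases (-1 / 8) (min x 0) with h1 | h1 <;>
          rcases min_cases x 0 with h2 | h2 <;> constructor <;> linarith
      · rw [abs_le]; constructor <;> dsimp only <;> linarith

/-! ### Convexity and minimality -/

theorem Convex.interior_closure_subset {E : Type*} [NormedAddCommGroup E] [NormedSpace ℝ E]
    {s : Set E} (hs : Convex ℝ s) (ho : IsOpen s) (hne : s.Nonempty) :
    interior (closure s) ⊆ s := by
  intro x hx
  obtain ⟨p, hp⟩ := hne
  -- Prolong the segment from `p` slightly beyond `x`, staying in the closure; then `x` lies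
  -- strictly between an interior point and a point of the closure.
  obtain ⟨t, ht, hmem⟩ : ∃ t : ℝ, 0 < t ∧ x + t • (x - p) ∈ closure s := by
    have hcont : ContinuousAt (fun t : ℝ => x + t • (x - p)) 0 := by fun_prop
    have hev := hcont.eventually_mem (s := closure s) (by
      rw [zero_smul, add_zero]
      exact mem_interior_iff_mem_nhds.1 hx)
    obtain ⟨t, ht, h⟩ := (hev.filter_mono nhdsWithin_le_nhds |>.and
      (self_mem_nhdsWithin (s := Ioi (0 : ℝ)))).exists
    exact ⟨t, h, ht⟩
  rw [← ho.interior_eq] at hp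
  have := hs.combo_interior_closure_mem_interior hp hmem (a := t / (1 + t)) (b := 1 / (1 + t))
    (by positivity) (by positivity) (by field_simp; ring)
  rw [ho.interior_eq] at this
  convert this using 1
  match_scalars <;> field_simp; ring

/-- A closure point on a segment gives its far end by convexity: `(1/3, 19/24)` lies below `(1/3,
1)` on the top side, and `(5/24, 2/3)` lies to the right of `(0, 2/3)` on the left side. -/
theorem deltaPrime_or_deltaDoublePrime_subset {H : Set (ℝ × ℝ)} (h : IsConvexTrapInDelta H) :
    deltaPrime ⊆ H ∨ deltaDoublePrime ⊆ H := by
  obtain ⟨⟨ho, hH⟩, hconv, hsub⟩ := h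
  have h01 := zero_one_mem_closure hH hsub
  have h0h := zero_half_mem_closure hH hsub
  have hh1 := half_one_mem_closure hH hsub
  have hint := hconv.interior_closure_subset ho (closure_nonempty_iff.1 ⟨_, h01⟩)
  have hcl := hconv.closure
  rcases exists_mem_closure_segments hH hsub with ⟨y, -, hy, hmem⟩ | ⟨x, hx, -, hmem⟩
  · right
    have htop : ((1 / 3 : ℝ), (1 : ℝ)) ∈ closure H := by
      have := hcl.mem_of_line (x := 1 / 3) (c := 1) (k := 0) (by simpa using h01)
        (by simpa using hh1) (by norm_num) (by norm_num)
      simpa using this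
    have := hcl.mem_of_mem_of_mem_of_le hmem htop hy (by norm_num)
    refine (interior_mono (convexHull_min ?_ hcl)).trans hint
    simp only [insert_subset_iff, singleton_subset_iff]
    exact ⟨h0h, this, hh1, h01⟩
  · left
    have hleft : ((0 : ℝ), (2 / 3 : ℝ)) ∈ closure H :=
      hcl.mem_of_mem_of_mem_of_le h0h h01 (by norm_num) (by norm_num)
    have := hcl.mem_of_line (x := 5 / 24) (c := 2 / 3) (k := 0) (by simpa using hleft)
        (by simpa using hmem) (by norm_num) hx
    refine (interior_mono (convexHull_min ?_ hcl)).trans hint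
    simp only [insert_subset_iff, singleton_subset_iff]
    exact ⟨h0h, by simpa using this, hh1, h01⟩

theorem isConvexTrapInDelta_deltaPrime : IsConvexTrapInDelta deltaPrime :=
  ⟨isDimensionTrap_deltaPrime, (convex_convexHull ℝ _).interior, deltaPrime_subset_bigDelta⟩

theorem isConvexTrapInDelta_deltaDoublePrime : IsConvexTrapInDelta deltaDoublePrime :=
  ⟨isDimensionTrap_deltaDoublePrime, (convex_convexHull ℝ _).interior,
    deltaDoublePrime_subset_bigDelta⟩

theorem setOf_minimal_isConvexTrapInDelta :
    {H : Set (ℝ × ℝ) | Minimal IsConvexTrapInDelta H} = {deltaPrime, deltaDoublePrime} := by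
  ext H
  simp only [mem_ofPred_eq, mem_insert_iff, mem_singleton_iff]
  constructor
  · intro hm
    rcases deltaPrime_or_deltaDoublePrime_subset hm.prop with h | h
    · exact .inl (hm.eq_of_subset isConvexTrapInDelta_deltaPrime h).symm
    · exact .inr (hm.eq_of_subset isConvexTrapInDelta_deltaDoublePrime h).symm
  · rintro (rfl | rfl)
    · refine ⟨isConvexTrapInDelta_deltaPrime, fun G hG hle => ?_⟩
      rcases deltaPrime_or_deltaDoublePrime_subset hG with h | h
      · exact h
      · exact absurd (h.trans hle) not_deltaDoublePrime_subset_deltaPrime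
    · refine ⟨isConvexTrapInDelta_deltaDoublePrime, fun G hG hle => ?_⟩
      rcases deltaPrime_or_deltaDoublePrime_subset hG with h | h
      · exact absurd (h.trans hle) not_deltaPrime_subset_deltaDoublePrime
      · exact h

theorem mainTheorem5 :
    -- both quadrilaterals are dimension traps
    (IsDimensionTrap deltaPrime ∧ IsDimensionTrap deltaDoublePrime) ∧
    -- the same for the survivor sets in the closed square
    (dimH (codedSurvivorSet deltaPrime) = 0 ∧ dimH (codedSurvivorSet deltaDoublePrime) = 0) ∧
    -- the projections of the survivor sets onto both axes have dimension zero
    (dimH (Prod.fst '' survivorSet deltaPrime) = 0 ∧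
      dimH (Prod.snd '' survivorSet deltaPrime) = 0 ∧
      dimH (Prod.fst '' survivorSet deltaDoublePrime) = 0 ∧
      dimH (Prod.snd '' survivorSet deltaDoublePrime) = 0) ∧
    -- every convex dimension trap inside `Δ` contains one of the two quadrilaterals
    (∀ H : Set (ℝ × ℝ), IsConvexTrapInDelta H → deltaPrime ⊆ H ∨ deltaDoublePrime ⊆ H) ∧
    -- they are exactly the minimal convex dimension traps inside `Δ`
    {H : Set (ℝ × ℝ) | Minimal IsConvexTrapInDelta H} = {deltaPrime, deltaDoublePrime} ∧
    -- their areas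
    (volume deltaPrime = ENNReal.ofReal (13 / 96) ∧
      volume deltaDoublePrime = ENNReal.ofReal (13 / 96)) :=
  ⟨⟨isDimensionTrap_deltaPrime, isDimensionTrap_deltaDoublePrime⟩,
    ⟨dimH_codedSurvivorSet_deltaPrime, dimH_codedSurvivorSet_deltaDoublePrime⟩,
    ⟨dimH_image_fst_eq_zero isDimensionTrap_deltaPrime.2,
      dimH_image_snd_eq_zero isDimensionTrap_deltaPrime.2,
      dimH_image_fst_eq_zero isDimensionTrap_deltaDoublePrime.2,
      dimH_image_snd_eq_zero isDimensionTrap_deltaDoublePrime.2⟩,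
    fun _ => deltaPrime_or_deltaDoublePrime_subset, setOf_minimal_isConvexTrapInDelta,
    volume_deltaPrime, volume_deltaDoublePrime⟩
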